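/- **Setting.** Let $A,A_1\in\mathbb R^{n\times n}$, $B\in\mathbb R^{n\times 1}$, $a,a_2\in\mathbb R$. For a gain $K\in\mathbb R^{1\times n}$ and a gain $c>0$ put $$\gamma(x)=\begin{bmatrix}K&0\end{bmatrix}\exp\!\left(\begin{bmatrix}0&A-aI\\ I&0\end{bmatrix}x\right)\begin{bmatrix}I\\0\end{bmatrix},\qquad q(x,y)=-(a+c)\,x\,\frac{I_1\big(\sqrt{(a+c)(x^2-y^2)}\big)}{\sqrt{(a+c)(x^2-y^2)}},\qquad g(x)=\gamma(x)-\int_0^xq(x,y)\gamma(y)\,dy,$$ where $I_1(s)=\sum_{m\ge0}\frac{(s/2)^{2m+1}}{m!(m+1)!}$ and $I_1(\sqrt s)/\sqrt s$ is understood as the entire function $\sum_{m\ge 0}\frac{(s/4)^m}{2\,m!(m+1)!}$ of $s$. Consider the target system $$\dot X(t)=(A+BK)X(t)+A_1X(t-\tau(t))+Bz(0,t),$$ $$z_t(x,t)=z_{xx}(x,t)-cz(x,t)+a_2z(x,t-\tau(t))-g(x)(A_1-a_2I)X(t-\tau(t)),\quad 0<x<1,$$ $$z_x(0,t)=0,\qquad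 z_x(1,t)=0,$$ for $t\ge 0$, with a $C^1$ delay satisfying $0<h_0\le\tau(t)\le h$, and with initial data $(X,z)=(f,\varphi)$ on $[-h,0]$ in $W=C([-h,0],D)\cap C^1([-h,0],\mathbb R^n\times H^1(0,1))$, where $D=\{(X,z)\in\mathbb R^n\times H^2(0,1): z'(0)=z'(1)=0\}$. Solutions are classical: $(X,z)\in C([0,\infty),D)$ is differentiable in $t\ge0$ with values in $\mathbb R^n\times L^2(0,1)$ and satisfies the equations for all $t\ge0$. For a matrix $P$, where $P>0$ means symmetric and positive definite (and similarly $M<0$), and scalars $p_1,p_2$, let $V_1(t)=X(t)^\top PX(t)+p_1\|z(\cdot,t)\|_{L^2}^2+p_2\|z_x(\cdot,t)\|_{L^2}^2$. Put $\zeta=\big(1+\max_{0\le y\le x\le1}|q(x,y)|\big)^2\big(\max_{0\le x\le1}|\gamma(x)|\big)^2$, $$R=\mathrm{diag}\{0,\ \zeta(A_1-a_2I)^\top(A_1-a_2I),\ 0\},\qquad \Xi=\begin{bmatrix}P(A+BK)+(A+BK)^\top P+2\delta_0P&PA_1&PB\\ *&-2\delta_1P&0\\ *&*&-\lambda\end{bmatrix},$$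 $$\bar\Theta_1=\Xi+(p_1r^{-1}+p_2r_1^{-1})R,\qquad \bar\Theta_2=\begin{bmatrix}(-2c+2\delta_0+r)p_1+2\lambda&a_2p_1&0\\ *&-2\delta_1p_1&-a_2p_2\\ *&*&-(2-r_1)p_2+\lambda_1\end{bmatrix}.$$ **Proposition.** (i) Let gains $K$, $c>0$ and tuning parameters $r>0$, $0<r_1<2$, $0<\delta_1<\delta_0$ be given, and suppose that $P>0$, $p_1>0$, $p_2>0$, $\lambda>0$, $\lambda_1\ge0$ satisfy $$\bar\Theta_1<0,\qquad\bar\Theta_2<0,\qquad -2p_1-2p_2c+\lambda+2\delta_0p_2-\tfrac{\pi^2}{4}\lambda_1\le0.\tag{$*$}$$ Then, for every $h>0$, the equation $\delta=\delta_0-\delta_1e^{2\delta h}$ has a unique real solution $\delta$, it is positive, and for all $h_0>0$, all delays $\tau(t)\in[h_0,h]$ and all solutions with initial data in $W$, $$V_1(t)\le e^{-2\delta t}\sup_{-h\le\theta\le0}V_1(\theta),\qquad t\ge0.\tag{$**$}$$ Moreover, if $(*)$ holds with $\delta_0=\delta_1>0$, then for every $h>0$ there is a $\delta>0$ such that $(**)$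 holds for all $h_0>0$, all delays $\tau(t)\in[h_0,h]$ and all solutions with initial data in $W$. (ii) Let $(A,B)$ be controllable and $A_1=a_1I$ with $a_1\in\mathbb R$. Then for all $h>0$ and $\delta>0$ there are gains $K$ and $c>0$ for which the target system is exponentially stable with decay rate $\delta$: there is a constant $M>0$ such that, for all $h_0>0$, all delays $\tau(t)\in[h_0,h]$, all solutions with initial data in $W$ and all $t\ge0$, $$|X(t)|^2+\|z(\cdot,t)\|_{L^2}^2+\|z_x(\cdot,t)\|_{L^2}^2\le Me^{-2\delta t}\sup_{-h\le\theta\le0}\big(|X(\theta)|^2+\|z(\cdot,\theta)\|_{L^2}^2+\|z_x(\cdot,\theta)\|_{L^2}^2\big).$$ -/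

import Mathlib

open MeasureTheory Set

noncomputable section

namespace HeatODE

/-! ### Kernels of the backstepping transformations -/

/-- The modified Bessel function `I₁`. -/
def besselI1 (s : ℝ) : ℝ :=
  ∑' m : ℕ, (s / 2) ^ (2 * m + 1) / ((m.factorial : ℝ) * ((m + 1).factorial : ℝ))

/-- The entire function `s ↦ I₁(√s) / √s` (with value `1 / 2` at `s = 0`), through its power
series; it is what the quotient means when `s` is zero or negative. -/
def besselI1Quot (s : ℝ) : ℝ :=
  ∑' m : ℕ, (s / 4) ^ m / (2 * (m.factorial : ℝ) * ((m + 1).factorial : ℝ))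

theorem besselI1Quot_eq {s : ℝ} (hs : 0 < s) :
    besselI1Quot s = besselI1 (Real.sqrt s) / Real.sqrt s := by
  have h0 : Real.sqrt s ≠ 0 := (Real.sqrt_pos.mpr hs).ne'
  rw [eq_div_iff h0, besselI1Quot, besselI1, ← tsum_mul_right]
  refine tsum_congr fun m => ?_
  have h1 : (Real.sqrt s / 2) ^ (2 * m + 1) = (s / 4) ^ m * (Real.sqrt s / 2) := by
    rw [pow_succ, pow_mul, div_pow, Real.sq_sqrt hs.le]
    norm_num
  rw [h1]
  have h2 : (m.factorial : ℝ) ≠ 0 := by exact_mod_cast m.factorial_ne_zero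
  have h3 : ((m + 1).factorial : ℝ) ≠ 0 := by exact_mod_cast (m + 1).factorial_ne_zero
  field_simp

/-- `q(x,y) = -(a+c) x I₁(√((a+c)(x²-y²))) / √((a+c)(x²-y²))`. -/
def kernelQ (a c x y : ℝ) : ℝ :=
  -(a + c) * x * besselI1Quot ((a + c) * (x ^ 2 - y ^ 2))

/-- The row vector `γ(x) = [K 0] exp([[0, A - aI], [I, 0]] x) [I; 0]`. -/
def gam {n : ℕ} (A : Matrix (Fin n) (Fin n) ℝ) (a : ℝ) (K : Matrix (Fin 1) (Fin n) ℝ)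
    (x : ℝ) : Fin n → ℝ :=
  (Matrix.fromCols K (0 : Matrix (Fin 1) (Fin n) ℝ) *
    (NormedSpace.exp (x • Matrix.fromBlocks (0 : Matrix (Fin n) (Fin n) ℝ)
      (A - a • (1 : Matrix (Fin n) (Fin n) ℝ)) 1 0) : Matrix (Fin n ⊕ Fin n) (Fin n ⊕ Fin n) ℝ) *
    Matrix.fromRows (1 : Matrix (Fin n) (Fin n) ℝ) (0 : Matrix (Fin n) (Fin n) ℝ) : Matrix (Fin 1) (Fin n) ℝ) 0

/-- The row vector `g(x) = γ(x) - ∫₀ˣ q(x,y) γ(y) dy`. -/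
def gFun {n : ℕ} (A : Matrix (Fin n) (Fin n) ℝ) (a : ℝ) (K : Matrix (Fin 1) (Fin n) ℝ)
    (c x : ℝ) : Fin n → ℝ :=
  fun j => gam A a K x j - ∫ y in (0 : ℝ)..x, kernelQ a c x y * gam A a K y j

/-! ### Sobolev spaces on `(0,1)` -/

/-- `L²(0,1)`. -/
abbrev L2 : Type := Lp ℝ 2 (volume.restrict (Ioo (0 : ℝ) 1))

/-- `u ∈ H¹(0,1)` with weak derivative `v ∈ L²(0,1)`: up to a null set, `u` is the absolutely
continuous function `x ↦ b + ∫₀ˣ v`. -/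
def HasDerivL2 (u v : L2) : Prop :=
  ∃ b : ℝ, ∀ᵐ x ∂(volume.restrict (Ioo (0 : ℝ) 1)), u x = b + ∫ y in (0 : ℝ)..x, v y

/-- The value at `x ∈ [0,1]` of the continuous representative of `u`, where `v` is the
derivative of `u`: the average over `y` of `u(y) + ∫_y^x v`. -/
def pointValue (u v : L2) (x : ℝ) : ℝ :=
  ∫ y in (0 : ℝ)..1, (u y + ∫ s in y..x, v s)

theorem L2.integrableOn (v : L2) : IntegrableOn v (Ioo (0 : ℝ) 1) :=
  (Lp.memLp v).integrable (by norm_num)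

theorem L2.intervalIntegrable (v : L2) {x y : ℝ} (hx : x ∈ Icc (0 : ℝ) 1)
    (hy : y ∈ Icc (0 : ℝ) 1) : IntervalIntegrable v volume x y := by
  have h : IntegrableOn v (Icc (0 : ℝ) 1) :=
    (integrableOn_Icc_iff_integrableOn_Ioo).mpr (L2.integrableOn v)
  have h2 : uIcc x y ⊆ Icc (0 : ℝ) 1 := uIcc_subset_Icc hx hy
  exact (h.mono_set h2).intervalIntegrable

theorem pointValue_eq {u v : L2} {b : ℝ}
    (h : ∀ᵐ x ∂(volume.restrict (Ioo (0 : ℝ) 1)), u x = b + ∫ y in (0 : ℝ)..x, v y)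
    {x : ℝ} (hx : x ∈ Icc (0 : ℝ) 1) : pointValue u v x = b + ∫ y in (0 : ℝ)..x, v y := by
  have h1 : pointValue u v x = ∫ _y in (0 : ℝ)..1, (b + ∫ y in (0 : ℝ)..x, v y) := by
    unfold pointValue
    rw [intervalIntegral.integral_of_le zero_le_one, intervalIntegral.integral_of_le zero_le_one,
      integral_Ioc_eq_integral_Ioo, integral_Ioc_eq_integral_Ioo]
    refine integral_congr_ae ?_
    filter_upwards [h, ae_restrict_mem measurableSet_Ioo] with y hy hy1
    have h0 : (0 : ℝ) ∈ Icc (0 : ℝ) 1 := ⟨le_refl _, zero_le_one⟩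
    have hy2 : y ∈ Icc (0 : ℝ) 1 := ⟨hy1.1.le, hy1.2.le⟩
    rw [hy, add_assoc, intervalIntegral.integral_add_adjacent_intervals
      (L2.intervalIntegrable v h0 hy2) (L2.intervalIntegrable v hy2 hx)]
  rw [h1]
  simp

/-- `H²(0,1)`, as the space of triples `(z, z_x, z_xx)` in `L²(0,1)³`; the norm it inherits is
equivalent to the usual one. -/
def sobolevH2 : Submodule ℝ (L2 × L2 × L2) where
  carrier := {p | HasDerivL2 p.1 p.2.1 ∧ HasDerivL2 p.2.1 p.2.2}
  zero_mem' := by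
    have h : HasDerivL2 0 0 := by
      refine ⟨0, ?_⟩
      have h0 := Lp.coeFn_zero ℝ 2 (volume.restrict (Ioo (0 : ℝ) 1))
      filter_upwards [h0, ae_restrict_mem measurableSet_Ioo] with x hx hx1
      rw [hx, intervalIntegral.integral_of_le hx1.1.le, integral_Ioc_eq_integral_Ioo]
      have h1 : ∫ y in Ioo (0 : ℝ) x, (0 : L2) y = ∫ y in Ioo (0 : ℝ) x, (0 : ℝ) :=
        integral_congr_ae (ae_restrict_of_ae_restrict_of_subset
          (Ioo_subset_Ioo_right hx1.2.le) h0)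
      rw [h1]
      simp
    exact ⟨h, h⟩
  add_mem' := by
    have h : ∀ u v u' v' : L2, HasDerivL2 u v → HasDerivL2 u' v' →
        HasDerivL2 (u + u') (v + v') := by
      rintro u v u' v' ⟨b, hb⟩ ⟨b', hb'⟩
      refine ⟨b + b', ?_⟩
      filter_upwards [hb, hb', Lp.coeFn_add u u', ae_restrict_mem measurableSet_Ioo]
        with x h1 h2 h3 hx1
      have h0 : (0 : ℝ) ∈ Icc (0 : ℝ) 1 := ⟨le_refl _, zero_le_one⟩
      have hx2 : x ∈ Icc (0 : ℝ) 1 := ⟨hx1.1.le, hx1.2.le⟩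
      have h4 : ∫ y in (0 : ℝ)..x, (v + v') y = ∫ y in (0 : ℝ)..x, (v y + v' y) := by
        rw [intervalIntegral.integral_of_le hx1.1.le, intervalIntegral.integral_of_le hx1.1.le,
          integral_Ioc_eq_integral_Ioo, integral_Ioc_eq_integral_Ioo]
        exact integral_congr_ae (ae_restrict_of_ae_restrict_of_subset
          (Ioo_subset_Ioo_right hx1.2.le) (Lp.coeFn_add v v'))
      rw [h3, h4, intervalIntegral.integral_add (L2.intervalIntegrable v h0 hx2)
        (L2.intervalIntegrable v' h0 hx2), Pi.add_apply, h1, h2]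
      ring
    exact fun {p q} hp hq => ⟨h _ _ _ _ hp.1 hq.1, h _ _ _ _ hp.2 hq.2⟩
  smul_mem' := by
    have h : ∀ (k : ℝ) (u v : L2), HasDerivL2 u v → HasDerivL2 (k • u) (k • v) := by
      rintro k u v ⟨b, hb⟩
      refine ⟨k * b, ?_⟩
      filter_upwards [hb, Lp.coeFn_smul k u, ae_restrict_mem measurableSet_Ioo] with x h1 h3 hx1
      have h4 : ∫ y in (0 : ℝ)..x, (k • v) y = ∫ y in (0 : ℝ)..x, k * v y := by
        rw [intervalIntegral.integral_of_le hx1.1.le, intervalIntegral.integral_of_le hx1.1.le,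
          integral_Ioc_eq_integral_Ioo, integral_Ioc_eq_integral_Ioo]
        exact integral_congr_ae (ae_restrict_of_ae_restrict_of_subset
          (Ioo_subset_Ioo_right hx1.2.le) (Lp.coeFn_smul k v))
      rw [h3, h4, intervalIntegral.integral_const_mul, Pi.smul_apply, h1, smul_eq_mul]
      ring
    exact fun k p hp => ⟨h _ _ _ hp.1, h _ _ _ hp.2⟩

/-- The space `H²(0,1)`. -/
abbrev H2 : Type := sobolevH2

/-- `z` as an element of `L²(0,1)`. -/
def H2.fn (z : H2) : L2 := z.1.1

/-- The derivative `z_x ∈ L²(0,1)`. -/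
def H2.dx (z : H2) : L2 := z.1.2.1

/-- The second derivative `z_xx ∈ L²(0,1)`. -/
def H2.dxx (z : H2) : L2 := z.1.2.2

/-- The point value `z(x)`, `x ∈ [0,1]`. -/
def H2.pt (z : H2) (x : ℝ) : ℝ := pointValue z.fn z.dx x

/-- The point value `z_x(x)`, `x ∈ [0,1]`. -/
def H2.dxAt (z : H2) (x : ℝ) : ℝ := pointValue z.dx z.dxx x

/-! ### The target system with Neumann boundary conditions -/

/-- `D(𝒜_z) = {(X, z) ∈ ℝⁿ × H²(0,1) | z_x(0) = z_x(1) = 0}`. -/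
def neumannDomain (n : ℕ) : Set ((Fin n → ℝ) × H2) :=
  {Y | Y.2.dxAt 0 = 0 ∧ Y.2.dxAt 1 = 0}

/-- The initial data `(f, φ)` belong to
`W = C([-h,0], D(𝒜_z)) ∩ C¹([-h,0], ℝⁿ × H¹(0,1))`. An element of `H¹(0,1)` is the pair of the
function and its derivative in `L²(0,1)²`. -/
structure InW {n : ℕ} (h : ℝ) (f : ℝ → Fin n → ℝ) (φ : ℝ → H2) : Prop where
  mem_domain : ∀ θ ∈ Icc (-h) 0, (f θ, φ θ) ∈ neumannDomain n
  continuousOn : ContinuousOn (fun θ => (f θ, φ θ)) (Icc (-h) 0)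
  contDiffOn : ContDiffOn ℝ 1 (fun θ => (f θ, (φ θ).fn, (φ θ).dx)) (Icc (-h) 0)

/-- `(X, z)`, given on `[-h,∞)`, is a classical solution on `[0,∞)` of
`X'(t) = (A+BK) X(t) + A₁ X(t-τ(t)) + B z(0,t)`,
`z_t = z_xx - c z + a₂ z(x,t-τ(t)) - g(x) (A₁ - a₂ I) X(t-τ(t))`, `z_x(0,t) = z_x(1,t) = 0`:
it is in `C([0,∞), D(𝒜_z))`, it is differentiable in time with values in `ℝⁿ × L²(0,1)`
(from the right at `t = 0`), and the equations hold for all `t ≥ 0`. -/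
structure IsClassicalSolution {n : ℕ} (A A1 : Matrix (Fin n) (Fin n) ℝ)
    (B : Matrix (Fin n) (Fin 1) ℝ) (a a2 : ℝ) (K : Matrix (Fin 1) (Fin n) ℝ) (c : ℝ)
    (τ : ℝ → ℝ) (X : ℝ → Fin n → ℝ) (z : ℝ → H2) : Prop where
  mem_domain : ∀ t ∈ Ici (0 : ℝ), (X t, z t) ∈ neumannDomain n
  continuousOn : ContinuousOn (fun t => (X t, z t)) (Ici 0)
  ode : ∀ t ∈ Ici (0 : ℝ), HasDerivWithinAt X
    (Matrix.mulVec (A + B * K) (X t) + Matrix.mulVec A1 (X (t - τ t))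
      + Matrix.mulVec B (fun _ => (z t).pt 0)) (Ici 0) t
  pde : ∀ t ∈ Ici (0 : ℝ), ∃ zt : L2,
    HasDerivWithinAt (fun s => (z s).fn) zt (Ici 0) t ∧
    ∀ᵐ x ∂(volume.restrict (Ioo (0 : ℝ) 1)),
      zt x = (z t).dxx x - c * (z t).fn x + a2 * (z (t - τ t)).fn x
        - dotProduct (gFun A a K c x)
            (Matrix.mulVec (A1 - a2 • (1 : Matrix (Fin n) (Fin n) ℝ)) (X (t - τ t)))

/-- The delay is continuously differentiable with `h₀ ≤ τ(t) ≤ h` for `t ≥ 0`. -/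
def IsDelay (h0 h : ℝ) (τ : ℝ → ℝ) : Prop :=
  ContDiffOn ℝ 1 τ (Ici 0) ∧ ∀ t ∈ Ici (0 : ℝ), h0 ≤ τ t ∧ τ t ≤ h

/-! ### Matrix inequalities and Lyapunov function -/

/-- `M < 0`: symmetric and negative definite. -/
def NegDef {ι : Type*} (M : Matrix ι ι ℝ) : Prop := (-M).PosDef

/-- `ζ = (1 + max_{0≤y≤x≤1} |q(x,y)|)² (max_{0≤x≤1} |γ(x)|)²`, with the Euclidean norm. -/
def zeta {n : ℕ} (A : Matrix (Fin n) (Fin n) ℝ) (a : ℝ) (K : Matrix (Fin 1) (Fin n) ℝ)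
    (c : ℝ) : ℝ :=
  (1 + sSup ((fun p : ℝ × ℝ => |kernelQ a c p.1 p.2|) ''
      {p : ℝ × ℝ | 0 ≤ p.2 ∧ p.2 ≤ p.1 ∧ p.1 ≤ 1})) ^ 2 *
    (sSup ((fun x : ℝ => Real.sqrt (dotProduct (gam A a K x) (gam A a K x))) ''
      Icc (0 : ℝ) 1)) ^ 2

/-- The symmetric `3 × 3` block matrix (block sizes `n`, `n`, `1`)
`[[M₁₁, M₁₂, M₁₃], [*, M₂₂, M₂₃], [*, *, M₃₃]]`. -/
def symBlock3 {n : ℕ} (M11 M12 : Matrix (Fin n) (Fin n) ℝ) (M13 : Matrix (Fin n) (Fin 1) ℝ)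
    (M22 : Matrix (Fin n) (Fin n) ℝ) (M23 : Matrix (Fin n) (Fin 1) ℝ)
    (M33 : Matrix (Fin 1) (Fin 1) ℝ) :
    Matrix (Fin n ⊕ (Fin n ⊕ Fin 1)) (Fin n ⊕ (Fin n ⊕ Fin 1)) ℝ :=
  Matrix.fromBlocks M11 (Matrix.fromCols M12 M13)
    (Matrix.fromRows M12.transpose M13.transpose)
    (Matrix.fromBlocks M22 M23 M23.transpose M33)

/-- `Ξ = [[θ₁₁, P A₁, P B], [*, -2δ₁ P, 0], [*, *, -λ]]`,
`θ₁₁ = P(A+BK) + (A+BK)ᵀ P + 2δ₀ P`. -/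
def Xi {n : ℕ} (A A1 : Matrix (Fin n) (Fin n) ℝ) (B : Matrix (Fin n) (Fin 1) ℝ)
    (K : Matrix (Fin 1) (Fin n) ℝ) (δ0 δ1 : ℝ) (P : Matrix (Fin n) (Fin n) ℝ) (lam : ℝ) :
    Matrix (Fin n ⊕ (Fin n ⊕ Fin 1)) (Fin n ⊕ (Fin n ⊕ Fin 1)) ℝ :=
  symBlock3 (P * (A + B * K) + (A + B * K).transpose * P + (2 * δ0) • P) (P * A1) (P * B)
    (-((2 * δ1) • P)) 0 (-(lam • (1 : Matrix (Fin 1) (Fin 1) ℝ)))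

/-- `R = diag{0, ζ (A₁ - a₂I)ᵀ (A₁ - a₂I), 0}`. -/
def Rmat {n : ℕ} (A A1 : Matrix (Fin n) (Fin n) ℝ) (a a2 : ℝ)
    (K : Matrix (Fin 1) (Fin n) ℝ) (c : ℝ) :
    Matrix (Fin n ⊕ (Fin n ⊕ Fin 1)) (Fin n ⊕ (Fin n ⊕ Fin 1)) ℝ :=
  symBlock3 0 0 0
    (zeta A a K c • ((A1 - a2 • (1 : Matrix (Fin n) (Fin n) ℝ)).transpose *
      (A1 - a2 • (1 : Matrix (Fin n) (Fin n) ℝ)))) 0 0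

/-- The conditions on `P`, `p₁`, `p₂`, `λ`, `λ₁`: the two matrix inequalities `Θ̄₁ < 0`,
`Θ̄₂ < 0` and the scalar inequality. -/
structure NeumannLMI {n : ℕ} (A A1 : Matrix (Fin n) (Fin n) ℝ) (B : Matrix (Fin n) (Fin 1) ℝ)
    (a a2 : ℝ) (K : Matrix (Fin 1) (Fin n) ℝ) (c r r1 δ0 δ1 : ℝ)
    (P : Matrix (Fin n) (Fin n) ℝ) (p1 p2 lam lam1 : ℝ) : Prop where
  P_posDef : P.PosDef
  p1_pos : 0 < p1
  p2_pos : 0 < p2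
  lam_pos : 0 < lam
  lam1_nonneg : 0 ≤ lam1
  theta1 : NegDef (Xi A A1 B K δ0 δ1 P lam + (p1 * r⁻¹ + p2 * r1⁻¹) • Rmat A A1 a a2 K c)
  theta2 : NegDef
    !![(-2 * c + 2 * δ0 + r) * p1 + 2 * lam, a2 * p1, 0;
       a2 * p1, -2 * δ1 * p1, -(a2 * p2);
       0, -(a2 * p2), -((2 - r1) * p2) + lam1]
  scalar : -2 * p1 - 2 * p2 * c + lam + 2 * δ0 * p2 - Real.pi ^ 2 / 4 * lam1 ≤ 0

/-- `V₁ = Xᵀ P X + p₁ ‖z‖² + p₂ ‖z_x‖²`. -/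
def V1 {n : ℕ} (P : Matrix (Fin n) (Fin n) ℝ) (p1 p2 : ℝ) (X : Fin n → ℝ) (z : H2) : ℝ :=
  dotProduct X (Matrix.mulVec P X) + p1 * ‖z.fn‖ ^ 2 + p2 * ‖z.dx‖ ^ 2

/-- The squared norm of `ℝⁿ × H¹(0,1)`: `|X|² + ‖z‖² + ‖z_x‖²`. -/
def normSqH1 {n : ℕ} (X : Fin n → ℝ) (z : H2) : ℝ :=
  dotProduct X X + ‖z.fn‖ ^ 2 + ‖z.dx‖ ^ 2

/-- `sup_{-h ≤ θ ≤ 0} v(θ)`. -/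
def histSup (h : ℝ) (v : ℝ → ℝ) : ℝ := sSup (v '' Icc (-h) 0)

/-- The Halanay estimate `V₁(t) ≤ e^{-2δt} sup_{-h≤θ≤0} V₁(θ)`, `t ≥ 0`, for all `h₀ > 0`, all
delays `τ(t) ∈ [h₀, h]` and all classical solutions with initial data in `W`. -/
def StableInV1 {n : ℕ} (A A1 : Matrix (Fin n) (Fin n) ℝ) (B : Matrix (Fin n) (Fin 1) ℝ)
    (a a2 : ℝ) (K : Matrix (Fin 1) (Fin n) ℝ) (c : ℝ) (P : Matrix (Fin n) (Fin n) ℝ)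
    (p1 p2 h δ : ℝ) : Prop :=
  ∀ h0 : ℝ, 0 < h0 → ∀ τ : ℝ → ℝ, IsDelay h0 h τ →
    ∀ (X : ℝ → Fin n → ℝ) (z : ℝ → H2), InW h X z →
      IsClassicalSolution A A1 B a a2 K c τ X z →
      ∀ t : ℝ, 0 ≤ t → V1 P p1 p2 (X t) (z t) ≤
        Real.exp (-2 * δ * t) * histSup h (fun θ => V1 P p1 p2 (X θ) (z θ))

/-- Exponential stability in `ℝⁿ × H¹(0,1)` with decay rate `δ`, uniformly in `h₀ > 0`, in the
delays `τ(t) ∈ [h₀, h]` and in the initial data in `W`. -/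
def ExpStable {n : ℕ} (A A1 : Matrix (Fin n) (Fin n) ℝ) (B : Matrix (Fin n) (Fin 1) ℝ)
    (a a2 : ℝ) (K : Matrix (Fin 1) (Fin n) ℝ) (c h δ : ℝ) : Prop :=
  ∃ M : ℝ, 0 < M ∧ ∀ h0 : ℝ, 0 < h0 → ∀ τ : ℝ → ℝ, IsDelay h0 h τ →
    ∀ (X : ℝ → Fin n → ℝ) (z : ℝ → H2), InW h X z →
      IsClassicalSolution A A1 B a a2 K c τ X z →
      ∀ t : ℝ, 0 ≤ t → normSqH1 (X t) (z t) ≤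
        M * Real.exp (-2 * δ * t) * histSup h (fun θ => normSqH1 (X θ) (z θ))

/-- `(A, B)` is controllable: `[B, AB, …, A^{n-1}B]` has rank `n`. -/
def Controllable {n : ℕ} (A : Matrix (Fin n) (Fin n) ℝ) (B : Matrix (Fin n) (Fin 1) ℝ) : Prop :=
  (Matrix.of fun i k : Fin n => (A ^ (k : ℕ) * B) i 0).rank = n

end HeatODE

end

/-!
Both parts rest on a quadratic Lyapunov function `V` that satisfies, along solutions, `V'(t) ≤ -2δ₀
V(t) + 2δ₁ V(t - τ(t))`, and on Halanay's inequality (`halanay`), which turns this into the decay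
rate `δ = δ₀ - δ₁ e^{2δh}`. The function is `V = XᵀPX + p₁ ‖e^{-μx} z‖² + p₂ ‖z_x‖²` (`lyap`). It
is differentiable in time although `z_x` need not be, because `‖z_x(s)‖² - ‖z_x(t)‖² = -⟨z(s) -
z(t), z_xx(s) + z_xx(t)⟩` under Neumann conditions (`hasDerivWithinAt_norm_dx_sq`). The facts
needed about `H¹` and `H²` come from one identity, the integral of `(ω u v)'` for a smooth weight
`ω` (`integral_deriv_weight_mul`): integration by parts, the trace inequality `z(0)² ≤ 2‖z‖² +
‖z_x‖²`, and Wirtinger's inequality.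

For the first part `μ = 0`, so that `V = V₁`, and the dissipation inequality is the sum of the
linear matrix inequalities with these two Sobolev inequalities (`NeumannLMI.dissipation`). If `δ₀ =
δ₁`, then `δ₁` can be decreased first: it enters only the strict inequalities.

For the second part the matrix inequalities are in general of no use: the bound `ζ` on the coupling
grows exponentially in `√c`, so that the small-gain argument behind them fails for large `c`. The
kernel `g` is large only away from `x = 0`, however, while `z` acts on `X` only through `z(0)`.
With `c = σ² - a` the identity `∫₀ˣ |q(x,y)| dy = cosh(σx) - 1` (`integral_abs_kernelQ`) gives
`|g(x)| ≤ Γ e^{σx}` with `Γ` independent of `c`. Under the weight `e^{-μx}`, `μ = σ - 1`, the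
coupling is therefore bounded uniformly in `c`, and the damping that remains is `c - μ² = 2σ - 1 -
a`, which is arbitrarily large (`dissipation_of_weight`). The gain `K` is chosen before `c`: the
inverse of the finite-horizon Gramian of `A + κI` is a Lyapunov matrix with rate `κ`
(`Controllable.exists_gain`), and a scalar delay matrix is compatible with the form of any such
`P`.
-/

noncomputable section

namespace HeatODE

open Matrix

/-! ### Halanay's inequality -/

/-- **Halanay's inequality** with a pointwise delay: if `V' ≤ -2δ₀ V + 2δ₁ V(t - τ(t))` and
`δ = δ₀ - δ₁ e^{2δh} > 0`, then `V` decays like `e^{-2δt}`. At a first time at which `V` reached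
`e^{-2δt} (S + ε)`, the inequality would force `V` to cross this barrier downwards. -/
theorem halanay {V V' τ : ℝ → ℝ} {h δ δ0 δ1 S : ℝ} (hδ1 : 0 < δ1) (hδ : 0 < δ)
    (hδeq : δ = δ0 - δ1 * Real.exp (2 * δ * h)) (hτ : ∀ t, 0 ≤ t → 0 < τ t ∧ τ t ≤ h)
    (hV : ∀ t, 0 ≤ t → HasDerivWithinAt V (V' t) (Ici 0) t)
    (hdiss : ∀ t, 0 ≤ t → V' t ≤ -2 * δ0 * V t + 2 * δ1 * V (t - τ t))
    (hS0 : 0 ≤ S) (hS : ∀ θ ∈ Icc (-h) 0, V θ ≤ S) {t : ℝ} (ht : 0 ≤ t) :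
    V t ≤ Real.exp (-2 * δ * t) * S := by
  have key : ∀ ε : ℝ, 0 < ε → V t ≤ Real.exp (-2 * δ * t) * (S + ε) := by
    intro ε hε
    by_contra! hlt
    set W : ℝ → ℝ := fun s => Real.exp (-2 * δ * s) * (S + ε) with hW
    have hWd : ∀ s, HasDerivAt W (-2 * δ * W s) s := by
      intro s
      have h1 : HasDerivAt (fun s : ℝ => -2 * δ * s) (-2 * δ) s := by
        simpa using (hasDerivAt_id s).const_mul (-2 * δ)
      refine (h1.exp.mul_const (S + ε)).congr_deriv ?_
      simp only [hW]
      ring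
    have hVc : ContinuousOn V (Icc 0 t) := fun s hs =>
      ((hV s hs.1).continuousWithinAt).mono Icc_subset_Ici_self
    have hWc : Continuous W := continuous_iff_continuousAt.mpr fun s => (hWd s).continuousAt
    have hclosed : IsCompact {s ∈ Icc 0 t | W s ≤ V s} :=
      isCompact_Icc.of_isClosed_subset
        (isClosed_Icc.isClosed_le hWc.continuousOn hVc) (sep_subset _ _)
    obtain ⟨s, ⟨hs, hsV⟩, hmin⟩ := hclosed.exists_isLeast ⟨t, ⟨ht, le_rfl⟩, hlt.le⟩
    have hh : 0 ≤ h := (hτ 0 le_rfl).1.le.trans (hτ 0 le_rfl).2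
    have hs0 : 0 < s := by
      rcases hs.1.eq_or_lt with h0 | h0
      · have h1 := hS 0 ⟨by linarith, le_rfl⟩
        rw [← h0] at hsV
        simp only [hW, mul_zero, Real.exp_zero, one_mul] at hsV
        linarith
      · exact h0
    have hbefore : ∀ u, -h ≤ u → u < s → V u < W u := by
      intro u hu hus
      rcases le_or_gt 0 u with h0 | h0
      · by_contra! hc
        exact absurd (hmin ⟨⟨h0, hus.le.trans hs.2⟩, hc⟩) (not_le.mpr hus)
      · have h1 := hS u ⟨hu, h0.le⟩
        have h2 : (1 : ℝ) ≤ Real.exp (-2 * δ * u) := Real.one_le_exp (by nlinarith)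
        have h3 : 1 * (S + ε) ≤ W u := mul_le_mul_of_nonneg_right h2 (by linarith)
        linarith
    have hder : HasDerivAt (fun u => V u - W u) (V' s - (-2 * δ * W s)) s :=
      ((hV s hs.1).hasDerivAt (Ici_mem_nhds hs0)).sub (hWd s)
    have hnn : 0 ≤ V' s - (-2 * δ * W s) := by
      have h1 := (hasDerivAt_iff_tendsto_slope.mp hder).mono_left
        (nhdsWithin_mono s (fun u (hu : u ∈ Iio s) => ne_of_lt hu))
      refine ge_of_tendsto h1 ?_
      filter_upwards [Ioo_mem_nhdsLT hs0] with u hu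
      have h2 := hbefore u (by linarith [hu.1]) hu.2
      rw [slope_def_field]
      exact div_nonneg_of_nonpos (by linarith) (by linarith [hu.2])
    have h1 := hdiss s hs.1
    obtain ⟨h2, h3⟩ := hτ s hs.1
    have h4 : V (s - τ s) < Real.exp (2 * δ * h) * W s := by
      refine (hbefore _ (by linarith) (by linarith)).trans_le ?_
      simp only [hW]
      rw [← mul_assoc, ← Real.exp_add]
      refine mul_le_mul_of_nonneg_right (Real.exp_le_exp.mpr ?_) (by linarith)
      nlinarith
    have hδ0 : 0 < δ0 := by
      have := mul_pos hδ1 (Real.exp_pos (2 * δ * h))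
      linarith
    have h5 : δ0 * W s ≤ δ0 * V s := mul_le_mul_of_nonneg_left hsV hδ0.le
    have h6 : δ1 * V (s - τ s) < δ1 * (Real.exp (2 * δ * h) * W s) :=
      mul_lt_mul_of_pos_left h4 hδ1
    have h7 : δ * W s = δ0 * W s - δ1 * (Real.exp (2 * δ * h) * W s) := by
      linear_combination W s * hδeq
    linarith
  refine le_of_forall_pos_le_add fun ε hε => ?_
  have he := Real.exp_pos (-2 * δ * t)
  have h1 := key (ε / Real.exp (-2 * δ * t)) (div_pos hε he)
  rwa [mul_add, mul_div_cancel₀ _ he.ne'] at h1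

theorem existsUnique_halanayRate (δ0 : ℝ) {δ1 h : ℝ} (hδ1 : 0 < δ1) (hh : 0 < h) :
    ∃! δ : ℝ, δ = δ0 - δ1 * Real.exp (2 * δ * h) := by
  have hmono : StrictMono fun δ : ℝ => δ + δ1 * Real.exp (2 * δ * h) := by
    intro x y hxy
    have h1 : Real.exp (2 * x * h) < Real.exp (2 * y * h) := Real.exp_lt_exp.mpr (by nlinarith)
    have h2 := mul_lt_mul_of_pos_left h1 hδ1
    simp only
    linarith
  have hcont : Continuous fun δ : ℝ => δ + δ1 * Real.exp (2 * δ * h) := by fun_prop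
  set b : ℝ := max δ0 0
  set l : ℝ := min (δ0 - δ1) 0
  have hl : l + δ1 * Real.exp (2 * l * h) ≤ δ0 := by
    have h0 : l ≤ 0 := min_le_right _ _
    have h1 : Real.exp (2 * l * h) ≤ 1 := Real.exp_le_one_iff.mpr (by nlinarith)
    have h2 : l ≤ δ0 - δ1 := min_le_left _ _
    nlinarith
  have hb : δ0 ≤ b + δ1 * Real.exp (2 * b * h) := by
    have h1 : δ0 ≤ b := le_max_left _ _
    have := mul_pos hδ1 (Real.exp_pos (2 * b * h))
    linarith
  obtain ⟨δ, -, hδ⟩ := intermediate_value_Icc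
    ((min_le_right _ _).trans (le_max_right _ _) : l ≤ b) hcont.continuousOn ⟨hl, hb⟩
  refine ⟨δ, by simp only at hδ ⊢; linarith, fun y hy => hmono.injective ?_⟩
  simp only at hδ hy ⊢
  linarith

theorem halanayRate_pos {δ δ0 δ1 h : ℝ} (hδ1 : 0 < δ1) (h01 : δ1 < δ0) (hh : 0 < h)
    (hδ : δ = δ0 - δ1 * Real.exp (2 * δ * h)) : 0 < δ := by
  by_contra! hneg
  have h1 : Real.exp (2 * δ * h) ≤ 1 := Real.exp_le_one_iff.mpr (by nlinarith)
  nlinarith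

/-! ### Quadratic forms -/

theorem abs_apply_mul_le_dotProduct {ι : Type*} [Fintype ι] (x : ι → ℝ) (i j : ι) :
    |x i * x j| ≤ x ⬝ᵥ x := by
  have h1 : ∀ k, x k * x k ≤ x ⬝ᵥ x := fun k =>
    Finset.single_le_sum (f := fun k => x k * x k) (fun k _ => mul_self_nonneg _)
      (Finset.mem_univ k)
  rw [abs_le]
  constructor <;> nlinarith [h1 i, h1 j, sq_nonneg (x i - x j), sq_nonneg (x i + x j)]

theorem dotProduct_self_nonneg {ι : Type*} [Fintype ι] (x : ι → ℝ) : 0 ≤ x ⬝ᵥ x :=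
  Finset.sum_nonneg fun _ _ => mul_self_nonneg _

/-- A quadratic form is bounded by a multiple of the square of the Euclidean norm. -/
theorem exists_abs_dotProduct_mulVec_le {ι : Type*} [Fintype ι] (M : Matrix ι ι ℝ) :
    ∃ C : ℝ, 0 < C ∧ ∀ x : ι → ℝ, |x ⬝ᵥ M *ᵥ x| ≤ C * (x ⬝ᵥ x) := by
  have h0 : 0 ≤ ∑ i, ∑ j, |M i j| :=
    Finset.sum_nonneg fun i _ => Finset.sum_nonneg fun j _ => abs_nonneg _
  refine ⟨∑ i, ∑ j, |M i j| + 1, by linarith, fun x => ?_⟩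
  have h1 : x ⬝ᵥ M *ᵥ x = ∑ i, ∑ j, M i j * (x i * x j) := by
    simp only [dotProduct, mulVec, Finset.mul_sum]
    exact Finset.sum_congr rfl fun i _ => Finset.sum_congr rfl fun j _ => by ring
  have h2 : |x ⬝ᵥ M *ᵥ x| ≤ (∑ i, ∑ j, |M i j|) * (x ⬝ᵥ x) := by
    rw [h1, Finset.sum_mul]
    refine (Finset.abs_sum_le_sum_abs _ _).trans (Finset.sum_le_sum fun i _ => ?_)
    rw [Finset.sum_mul]
    refine (Finset.abs_sum_le_sum_abs _ _).trans (Finset.sum_le_sum fun j _ => ?_)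
    rw [abs_mul]
    exact mul_le_mul_of_nonneg_left (abs_apply_mul_le_dotProduct x i j) (abs_nonneg _)
  have h3 : 0 ≤ x ⬝ᵥ x := dotProduct_self_nonneg x
  linarith

/-- A positive definite form dominates a multiple of the square of the Euclidean norm. -/
theorem exists_le_dotProduct_mulVec {ι : Type*} [Fintype ι] {M : Matrix ι ι ℝ} (hM : M.PosDef) :
    ∃ m : ℝ, 0 < m ∧ ∀ x : ι → ℝ, m * (x ⬝ᵥ x) ≤ x ⬝ᵥ M *ᵥ x := by
  have hc1 : Continuous fun x : ι → ℝ => x ⬝ᵥ x := by fun_prop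
  have hc2 : Continuous fun x : ι → ℝ => x ⬝ᵥ M *ᵥ x := by fun_prop
  have hcpt : IsCompact {x : ι → ℝ | x ⬝ᵥ x = 1} := by
    refine (isCompact_closedBall (0 : ι → ℝ) 1).of_isClosed_subset
      (isClosed_eq hc1 continuous_const) fun x hx => ?_
    rw [mem_closedBall_zero_iff, pi_norm_le_iff_of_nonneg zero_le_one]
    intro i
    have h1 := abs_apply_mul_le_dotProduct x i i
    rw [show x ⬝ᵥ x = 1 from hx, abs_mul] at h1
    rw [Real.norm_eq_abs]
    nlinarith [abs_nonneg (x i)]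
  have hscale : ∀ m : ℝ, (∀ y : ι → ℝ, y ⬝ᵥ y = 1 → m ≤ y ⬝ᵥ M *ᵥ y) →
      ∀ x : ι → ℝ, m * (x ⬝ᵥ x) ≤ x ⬝ᵥ M *ᵥ x := by
    intro m hm x
    rcases (dotProduct_self_nonneg x).eq_or_lt with h | h
    · have hx : x = 0 := dotProduct_self_eq_zero.mp h.symm
      simp [hx]
    · set s := Real.sqrt (x ⬝ᵥ x)
      have hs : 0 < s := Real.sqrt_pos.mpr h
      have hss : s * s = x ⬝ᵥ x := Real.mul_self_sqrt h.le
      have h1 := hm (s⁻¹ • x) (by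
        rw [smul_dotProduct, dotProduct_smul, smul_eq_mul, smul_eq_mul, ← hss]
        field_simp)
      rw [mulVec_smul, smul_dotProduct, dotProduct_smul, smul_eq_mul, smul_eq_mul,
        ← mul_assoc, ← mul_inv, inv_mul_eq_div, le_div_iff₀ (mul_pos hs hs), hss] at h1
      exact h1
  rcases {x : ι → ℝ | x ⬝ᵥ x = 1}.eq_empty_or_nonempty with he | hne
  · exact ⟨1, one_pos, hscale 1 fun y hy => absurd (he ▸ hy : y ∈ (∅ : Set (ι → ℝ)))
      (notMem_empty y)⟩
  · obtain ⟨y, hy, hmin⟩ := hcpt.exists_isMinOn hne hc2.continuousOn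
    refine ⟨y ⬝ᵥ M *ᵥ y, ?_, hscale _ fun x hx => hmin hx⟩
    have hy0 : y ≠ 0 := by
      rintro rfl
      simp at hy
    simpa using hM.dotProduct_mulVec_pos hy0

/-- Positive definiteness is stable under small symmetric perturbations. -/
theorem exists_posDef_sub_smul {ι : Type*} [Fintype ι] {M N : Matrix ι ι ℝ} (hM : M.PosDef)
    (hN : N.IsHermitian) : ∃ ε0 : ℝ, 0 < ε0 ∧ ∀ ε, 0 ≤ ε → ε ≤ ε0 → (M - ε • N).PosDef := by
  obtain ⟨m, hm, hmM⟩ := exists_le_dotProduct_mulVec hM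
  obtain ⟨C, hC, hCN⟩ := exists_abs_dotProduct_mulVec_le N
  refine ⟨m / (2 * C), by positivity, fun ε hε0 hε => ?_⟩
  refine PosDef.of_dotProduct_mulVec_pos ?_ fun {x} hx => ?_
  · rw [IsHermitian, conjTranspose_sub, conjTranspose_smul, hM.isHermitian.eq, hN.eq, star_trivial]
  · have hx0 : 0 < x ⬝ᵥ x := lt_of_le_of_ne (dotProduct_self_nonneg x)
      fun h => hx (dotProduct_self_eq_zero.mp h.symm)
    have h1 : ε * (x ⬝ᵥ N *ᵥ x) ≤ m / 2 * (x ⬝ᵥ x) := by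
      have h2 : ε * (x ⬝ᵥ N *ᵥ x) ≤ ε * (C * (x ⬝ᵥ x)) :=
        mul_le_mul_of_nonneg_left ((le_abs_self _).trans (hCN x)) hε0
      have h3 : ε * (2 * C) ≤ m := (le_div_iff₀ (by positivity)).mp hε
      nlinarith
    rw [star_trivial, sub_mulVec, smul_mulVec, dotProduct_sub, dotProduct_smul, smul_eq_mul]
    nlinarith [hmM x]

theorem dotProduct_mulVec_comm {ι : Type*} [Fintype ι] {P : Matrix ι ι ℝ} (hP : P.PosDef)
    (x y : ι → ℝ) : x ⬝ᵥ P *ᵥ y = y ⬝ᵥ P *ᵥ x := by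
  have h1 : Pᵀ = P := by simpa using hP.isHermitian.eq
  rw [dotProduct_mulVec, ← mulVec_transpose, h1, dotProduct_comm]

theorem dotProduct_mulVec_self_nonneg {ι : Type*} [Fintype ι] {P : Matrix ι ι ℝ}
    (hP : P.PosDef) (x : ι → ℝ) : 0 ≤ x ⬝ᵥ P *ᵥ x := by
  simpa using hP.posSemidef.dotProduct_mulVec_nonneg x

/-- Young's inequality `2 xᵀPy ≤ s xᵀPx + s⁻¹ yᵀPy` for the form of a positive definite `P`. -/
theorem two_mul_dotProduct_mulVec_le {ι : Type*} [Fintype ι] {P : Matrix ι ι ℝ} (hP : P.PosDef)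
    {s : ℝ} (hs : 0 < s) (x y : ι → ℝ) :
    2 * (x ⬝ᵥ P *ᵥ y) ≤ s * (x ⬝ᵥ P *ᵥ x) + s⁻¹ * (y ⬝ᵥ P *ᵥ y) := by
  have h1 := dotProduct_mulVec_self_nonneg hP (s • x - y)
  rw [mulVec_sub, mulVec_smul, dotProduct_sub, sub_dotProduct, sub_dotProduct, smul_dotProduct,
    smul_dotProduct, dotProduct_smul, dotProduct_smul, dotProduct_mulVec_comm hP y x] at h1
  simp only [smul_eq_mul] at h1
  have h2 : s * (x ⬝ᵥ P *ᵥ x) + s⁻¹ * (y ⬝ᵥ P *ᵥ y) - 2 * (x ⬝ᵥ P *ᵥ y) =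
      s⁻¹ * (s * (s * (x ⬝ᵥ P *ᵥ x)) - s * (x ⬝ᵥ P *ᵥ y) - (s * (x ⬝ᵥ P *ᵥ y)
        - y ⬝ᵥ P *ᵥ y)) := by
    field_simp
    ring
  have h3 := mul_nonneg (inv_pos.mpr hs).le h1
  linarith

theorem dotProduct_sq_le {ι : Type*} [Fintype ι] (x y : ι → ℝ) :
    (x ⬝ᵥ y) ^ 2 ≤ (x ⬝ᵥ x) * (y ⬝ᵥ y) := by
  have h := Finset.sum_mul_sq_le_sq_mul_sq Finset.univ x y
  simpa only [dotProduct, sq] using h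

theorem dotProduct_symBlock3_mulVec {n : ℕ} (M11 M12 : Matrix (Fin n) (Fin n) ℝ)
    (M13 : Matrix (Fin n) (Fin 1) ℝ) (M22 : Matrix (Fin n) (Fin n) ℝ)
    (M23 : Matrix (Fin n) (Fin 1) ℝ) (M33 : Matrix (Fin 1) (Fin 1) ℝ) (x y : Fin n → ℝ)
    (s : Fin 1 → ℝ) :
    Sum.elim x (Sum.elim y s) ⬝ᵥ symBlock3 M11 M12 M13 M22 M23 M33 *ᵥ
        Sum.elim x (Sum.elim y s) =
      x ⬝ᵥ M11 *ᵥ x + 2 * (x ⬝ᵥ M12 *ᵥ y) + 2 * (x ⬝ᵥ M13 *ᵥ s) + y ⬝ᵥ M22 *ᵥ y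
        + 2 * (y ⬝ᵥ M23 *ᵥ s) + s ⬝ᵥ M33 *ᵥ s := by
  have ht : ∀ {m k : ℕ} (M : Matrix (Fin m) (Fin k) ℝ) (u : Fin k → ℝ) (v : Fin m → ℝ),
      u ⬝ᵥ Mᵀ *ᵥ v = v ⬝ᵥ M *ᵥ u := by
    intro m k M u v
    rw [mulVec_transpose, dotProduct_comm, dotProduct_mulVec]
  simp only [symBlock3, fromBlocks_mulVec, Sum.elim_comp_inl, Sum.elim_comp_inr,
    fromCols_mulVec_sumElim, fromRows_mulVec, sumElim_dotProduct_sumElim, dotProduct_add,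
    ← Sum.elim_add_add, ht]
  ring

/-! ### Stabilization by a finite-horizon Gramian -/

/-- The linear flow `β(t) = e^{-Ft} b`. -/
theorem exists_linear_flow {n : ℕ} (F : Matrix (Fin n) (Fin n) ℝ) (b : Fin n → ℝ) :
    ∃ β : ℝ → Fin n → ℝ, β 0 = b ∧ ∀ t, HasDerivAt β (-(F *ᵥ β t)) t := by
  set L : (Fin n → ℝ) →L[ℝ] (Fin n → ℝ) := LinearMap.toContinuousLinearMap (Matrix.toLin' (-F))
  refine ⟨fun t => NormedSpace.exp (t • L) b, by simp, fun t => ?_⟩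
  have h := (hasDerivAt_exp_smul_const' (𝕂 := ℝ) L t).clm_apply (hasDerivAt_const t b)
  refine h.congr_deriv ?_
  simp [L]

theorem hasDerivAt_dotProduct {n : ℕ} (u : Fin n → ℝ) {β : ℝ → Fin n → ℝ} {β' : Fin n → ℝ}
    {t : ℝ} (hβ : HasDerivAt β β' t) : HasDerivAt (fun t => u ⬝ᵥ β t) (u ⬝ᵥ β') t := by
  simp only [dotProduct]
  exact HasDerivAt.fun_sum fun i _ => ((hasDerivAt_pi.mp hβ) i).const_mul (u i)

/-- Kalman's rank condition: no nonzero row vector annihilates all `A^k B`. -/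
theorem Controllable.eq_zero {n : ℕ} {A : Matrix (Fin n) (Fin n) ℝ} {B : Matrix (Fin n) (Fin 1) ℝ}
    (h : Controllable A B) {x : Fin n → ℝ} (hx : ∀ k : ℕ, x ⬝ᵥ (A ^ k) *ᵥ B.col 0 = 0) :
    x = 0 := by
  set C : Matrix (Fin n) (Fin n) ℝ := Matrix.of fun i k : Fin n => (A ^ (k : ℕ) * B) i 0
  have hC : C.rank = n := h
  have htop : LinearMap.range C.mulVecLin = ⊤ := by
    refine Submodule.eq_top_of_finrank_eq ?_
    rw [Module.finrank_fin_fun]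
    exact hC
  obtain ⟨v, hv⟩ := LinearMap.range_eq_top.mp htop x
  have hxC : x ᵥ* C = 0 := by
    funext k
    exact hx k
  have h1 : x ⬝ᵥ x = 0 := by
    have h2 : x ⬝ᵥ C *ᵥ v = 0 := by rw [dotProduct_mulVec, hxC, zero_dotProduct]
    rwa [show C *ᵥ v = x from hv] at h2
  exact dotProduct_self_eq_zero.mp h1

/-- A row vector orthogonal to the orbit `e^{-(A + κ)t} B` on a time interval annihilates all
`A^k B`. -/
theorem Controllable.exists_flow_ne_zero {n : ℕ} {A : Matrix (Fin n) (Fin n) ℝ}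
    {B : Matrix (Fin n) (Fin 1) ℝ} (h : Controllable A B) (κ : ℝ) {β : ℝ → Fin n → ℝ}
    (hβ0 : β 0 = B.col 0)
    (hβ : ∀ t, HasDerivAt β (-((A + κ • (1 : Matrix (Fin n) (Fin n) ℝ)) *ᵥ β t)) t)
    {x : Fin n → ℝ} (hx : x ≠ 0) : ∃ t ∈ Icc (0 : ℝ) 1, x ⬝ᵥ β t ≠ 0 := by
  by_contra! hcon
  refine hx (h.eq_zero fun k => ?_)
  have hβc : Continuous β := continuous_iff_continuousAt.mpr fun t => (hβ t).continuousAt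
  have hz : ∀ k : ℕ, ∀ t ∈ Ioo (0 : ℝ) 1, x ⬝ᵥ (A ^ k) *ᵥ β t = 0 := by
    intro k
    induction k with
    | zero => intro t ht; simpa using hcon t (Ioo_subset_Icc_self ht)
    | succ k ih =>
      intro t ht
      have h1 : HasDerivAt (fun t => x ⬝ᵥ (A ^ k) *ᵥ β t)
          (x ⬝ᵥ (A ^ k) *ᵥ (-((A + κ • (1 : Matrix (Fin n) (Fin n) ℝ)) *ᵥ β t))) t := by
        simp only [dotProduct_mulVec]
        exact hasDerivAt_dotProduct _ (hβ t)
      have h2 : HasDerivAt (fun t => x ⬝ᵥ (A ^ k) *ᵥ β t) 0 t :=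
        (hasDerivAt_const t (0 : ℝ)).congr_of_eventuallyEq
          (Filter.eventually_of_mem (Ioo_mem_nhds ht.1 ht.2) ih)
      have h3 := h1.unique h2
      rw [add_mulVec, smul_mulVec, one_mulVec, mulVec_neg, mulVec_add, mulVec_smul,
        mulVec_mulVec, ← pow_succ, dotProduct_neg, dotProduct_add, dotProduct_smul, ih t ht,
        smul_zero, add_zero, neg_eq_zero] at h3
      exact h3
  have hc : Continuous fun t => x ⬝ᵥ (A ^ k) *ᵥ β t := by fun_prop
  have hcl : IsClosed {t | x ⬝ᵥ (A ^ k) *ᵥ β t = 0} := isClosed_eq hc continuous_const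
  have h0 : (0 : ℝ) ∈ closure (Ioo (0 : ℝ) 1) := by
    rw [closure_Ioo zero_ne_one]
    exact ⟨le_rfl, zero_le_one⟩
  have h1 : (0 : ℝ) ∈ {t | x ⬝ᵥ (A ^ k) *ᵥ β t = 0} :=
    hcl.closure_subset_iff.mpr (hz k) h0
  rw [← hβ0]
  exact h1

/-- For a controllable pair, every decay rate `κ` is assigned by some gain, together with a
quadratic Lyapunov function. With `F = A + κI`, `b(t) = e^{-Ft} B` and the Gramian
`W = ∫₀¹ b bᵀ`, one has `F W + W Fᵀ = B Bᵀ - b(1) b(1)ᵀ`, so that `K = -Bᵀ W⁻¹` and `P = W⁻¹`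
do. -/
theorem Controllable.exists_gain {n : ℕ} {A : Matrix (Fin n) (Fin n) ℝ}
    {B : Matrix (Fin n) (Fin 1) ℝ} (h : Controllable A B) (κ : ℝ) :
    ∃ (K : Matrix (Fin 1) (Fin n) ℝ) (P : Matrix (Fin n) (Fin n) ℝ), P.PosDef ∧
      ∀ x : Fin n → ℝ, x ⬝ᵥ P *ᵥ ((A + B * K) *ᵥ x) ≤ -κ * (x ⬝ᵥ P *ᵥ x) := by
  set F : Matrix (Fin n) (Fin n) ℝ := A + κ • (1 : Matrix (Fin n) (Fin n) ℝ) with hF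
  obtain ⟨β, hβ0, hβ⟩ := exists_linear_flow F (B.col 0)
  have hβc : Continuous β := continuous_iff_continuousAt.mpr fun t => (hβ t).continuousAt
  set W : Matrix (Fin n) (Fin n) ℝ := Matrix.of fun i j => ∫ t in (0 : ℝ)..1, β t i * β t j
    with hW
  have hint : ∀ f : ℝ → ℝ, Continuous f → IntervalIntegrable f volume 0 1 :=
    fun f hf => hf.intervalIntegrable _ _
  have hWform : ∀ u v : Fin n → ℝ,
      u ⬝ᵥ W *ᵥ v = ∫ t in (0 : ℝ)..1, (u ⬝ᵥ β t) * (v ⬝ᵥ β t) := by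
    intro u v
    have h1 : ∀ t, (u ⬝ᵥ β t) * (v ⬝ᵥ β t) = ∑ i, ∑ j, u i * (v j * (β t i * β t j)) := by
      intro t
      simp only [dotProduct, Finset.sum_mul_sum]
      exact Finset.sum_congr rfl fun i _ => Finset.sum_congr rfl fun j _ => by ring
    simp only [h1]
    rw [intervalIntegral.integral_finsetSum fun i _ => hint _ (by fun_prop)]
    simp only [dotProduct, mulVec, Finset.mul_sum]
    refine Finset.sum_congr rfl fun i _ => ?_
    rw [intervalIntegral.integral_finsetSum fun j _ => hint _ (by fun_prop)]
    refine Finset.sum_congr rfl fun j _ => ?_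
    rw [intervalIntegral.integral_const_mul, intervalIntegral.integral_const_mul]
    simp only [hW, Matrix.of_apply]
    ring
  have hWpos : W.PosDef := by
    refine PosDef.of_dotProduct_mulVec_pos ?_ fun {x} hx => ?_
    · ext i j
      simp [hW, mul_comm]
    · rw [star_trivial, hWform]
      obtain ⟨t, ht, hne⟩ := h.exists_flow_ne_zero κ hβ0 hβ hx
      refine intervalIntegral.integral_pos zero_lt_one (Continuous.continuousOn (by fun_prop))
        (fun s _ => mul_self_nonneg _) ⟨t, ht, mul_self_pos.mpr hne⟩
  have hLyap : ∀ u : Fin n → ℝ, 2 * (u ⬝ᵥ F *ᵥ (W *ᵥ u)) ≤ (u ⬝ᵥ B.col 0) ^ 2 := by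
    intro u
    have hd : ∀ t ∈ uIcc (0 : ℝ) 1, HasDerivAt (fun t => (u ⬝ᵥ β t) * (u ⬝ᵥ β t))
        (-2 * (((Fᵀ *ᵥ u) ⬝ᵥ β t) * (u ⬝ᵥ β t))) t := by
      intro t _
      have h1 : HasDerivAt (fun t => u ⬝ᵥ β t) (u ⬝ᵥ -(F *ᵥ β t)) t :=
        hasDerivAt_dotProduct u (hβ t)
      refine (h1.fun_mul h1).congr_deriv ?_
      rw [dotProduct_neg, dotProduct_mulVec, ← mulVec_transpose]
      ring
    have h1 := intervalIntegral.integral_eq_sub_of_hasDerivAt hd (hint _ (by fun_prop))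
    rw [intervalIntegral.integral_const_mul, ← hWform, hβ0] at h1
    have h2 : u ⬝ᵥ F *ᵥ (W *ᵥ u) = (Fᵀ *ᵥ u) ⬝ᵥ W *ᵥ u := by
      rw [dotProduct_mulVec, ← mulVec_transpose]
    rw [h2]
    nlinarith [mul_self_nonneg (u ⬝ᵥ β 1)]
  have hunit : IsUnit W.det := (Matrix.isUnit_iff_isUnit_det W).mp hWpos.isUnit
  refine ⟨-(Bᵀ * W⁻¹), W⁻¹, hWpos.inv, fun x => ?_⟩
  set u := W⁻¹ *ᵥ x with hu
  have hWu : W *ᵥ u = x := by rw [hu, mulVec_mulVec, mul_nonsing_inv W hunit, one_mulVec]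
  have hsym : ∀ y, x ⬝ᵥ W⁻¹ *ᵥ y = u ⬝ᵥ y := fun y => by
    rw [dotProduct_mulVec_comm hWpos.inv, dotProduct_comm]
  have hK : B *ᵥ (Bᵀ *ᵥ u) = (u ⬝ᵥ B.col 0) • B.col 0 := by
    funext i
    simp [mulVec, dotProduct, Matrix.col, mul_comm]
  have h1 := hLyap u
  rw [hWu, hF, add_mulVec, smul_mulVec, one_mulVec, dotProduct_add, dotProduct_smul,
    smul_eq_mul] at h1
  rw [hsym, hsym, add_mulVec, ← mulVec_mulVec, neg_mulVec, ← mulVec_mulVec, ← hu, mulVec_neg, hK,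
    dotProduct_add, dotProduct_neg, dotProduct_smul, smul_eq_mul]
  nlinarith [sq_nonneg (u ⬝ᵥ B.col 0)]

/-! ### The kernels -/

theorem summable_besselI1Quot_bound (R : ℝ) :
    Summable fun m : ℕ => R ^ m / (2 * (m.factorial : ℝ) * ((m + 1).factorial : ℝ)) := by
  refine (Real.summable_pow_div_factorial |R|).of_norm_bounded fun m => ?_
  have h1 : (0 : ℝ) < m.factorial := by exact_mod_cast m.factorial_pos
  have h2 : (1 : ℝ) ≤ (m + 1).factorial := by exact_mod_cast (m + 1).factorial_pos
  rw [Real.norm_eq_abs, abs_div, abs_pow, abs_of_pos (by positivity : (0 : ℝ) <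
    2 * (m.factorial : ℝ) * ((m + 1).factorial : ℝ))]
  exact div_le_div_of_nonneg_left (by positivity) h1 (by nlinarith)

theorem continuous_besselI1Quot : Continuous besselI1Quot := by
  rw [continuous_iff_continuousAt]
  intro s
  have h : ContinuousOn besselI1Quot (Icc (-(|s| + 1)) (|s| + 1)) := by
    refine continuousOn_tsum (fun m => by fun_prop)
      (summable_besselI1Quot_bound ((|s| + 1) / 4)) fun m x hx => ?_
    have h1 : (0 : ℝ) < 2 * (m.factorial : ℝ) * ((m + 1).factorial : ℝ) := by
      positivity
    rw [Real.norm_eq_abs, abs_div, abs_pow, abs_of_pos h1, abs_div, abs_of_pos (four_pos (α := ℝ))]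
    have h2 : |x| ≤ |s| + 1 := abs_le.mpr hx
    gcongr
  exact h.continuousAt (Icc_mem_nhds (by linarith [neg_abs_le s]) (by linarith [le_abs_self s]))

theorem continuous_kernelQ (a c : ℝ) : Continuous fun p : ℝ × ℝ => kernelQ a c p.1 p.2 := by
  unfold kernelQ
  have := continuous_besselI1Quot
  fun_prop

section
attribute [local instance] Matrix.linftyOpNormedRing Matrix.linftyOpNormedAlgebra

theorem continuous_gam {n : ℕ} (A : Matrix (Fin n) (Fin n) ℝ) (a : ℝ)
    (K : Matrix (Fin 1) (Fin n) ℝ) : Continuous (gam A a K) := by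
  have h : Continuous fun x : ℝ => (NormedSpace.exp (x • Matrix.fromBlocks
      (0 : Matrix (Fin n) (Fin n) ℝ) (A - a • (1 : Matrix (Fin n) (Fin n) ℝ)) 1 0) :
        Matrix (Fin n ⊕ Fin n) (Fin n ⊕ Fin n) ℝ) :=
    NormedSpace.exp_continuous.comp (continuous_id.smul continuous_const)
  unfold gam
  refine (continuous_apply (0 : Fin 1)).comp ?_
  exact (continuous_const.matrix_mul h).matrix_mul continuous_const
end


theorem gFun_dotProduct {n : ℕ} (A : Matrix (Fin n) (Fin n) ℝ) (a : ℝ)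
    (K : Matrix (Fin 1) (Fin n) ℝ) (c x : ℝ) (v : Fin n → ℝ) :
    gFun A a K c x ⬝ᵥ v =
      gam A a K x ⬝ᵥ v - ∫ y in (0 : ℝ)..x, kernelQ a c x y * (gam A a K y ⬝ᵥ v) := by
  have hγ := continuous_gam A a K
  have hq : Continuous fun y : ℝ => kernelQ a c x y :=
    (continuous_kernelQ a c).comp (by fun_prop : Continuous fun y : ℝ => (x, y))
  have h1 : ∫ y in (0 : ℝ)..x, kernelQ a c x y * (gam A a K y ⬝ᵥ v) =
      ∑ j, (∫ y in (0 : ℝ)..x, kernelQ a c x y * gam A a K y j) * v j := by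
    simp only [dotProduct, Finset.mul_sum]
    rw [intervalIntegral.integral_finsetSum]
    · refine Finset.sum_congr rfl fun j _ => ?_
      rw [← intervalIntegral.integral_mul_const]
      simp only [mul_assoc]
    · intro j _
      refine Continuous.intervalIntegrable ?_ _ _
      fun_prop
  rw [h1]
  simp only [dotProduct, gFun, sub_mul, Finset.sum_sub_distrib]

/-- If `|γ(y) v| ≤ Γ` on `[0,1]`, then `|g(x) v| ≤ (1 + ∫₀ˣ |q(x,y)| dy) Γ`. -/
theorem abs_gFun_dotProduct_le {n : ℕ} (A : Matrix (Fin n) (Fin n) ℝ) (a : ℝ)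
    (K : Matrix (Fin 1) (Fin n) ℝ) (c : ℝ) {x Γ : ℝ} (hx : x ∈ Icc (0 : ℝ) 1) {v : Fin n → ℝ}
    (hΓ : ∀ y ∈ Icc (0 : ℝ) 1, |gam A a K y ⬝ᵥ v| ≤ Γ) :
    |gFun A a K c x ⬝ᵥ v| ≤ (1 + ∫ y in (0 : ℝ)..x, |kernelQ a c x y|) * Γ := by
  have hq : Continuous fun y : ℝ => kernelQ a c x y :=
    (continuous_kernelQ a c).comp (by fun_prop : Continuous fun y : ℝ => (x, y))
  have h1 : |∫ y in (0 : ℝ)..x, kernelQ a c x y * (gam A a K y ⬝ᵥ v)| ≤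
      (∫ y in (0 : ℝ)..x, |kernelQ a c x y|) * Γ := by
    rw [← intervalIntegral.integral_mul_const, ← Real.norm_eq_abs]
    refine intervalIntegral.norm_integral_le_of_norm_le hx.1 ?_
      ((hq.abs.mul continuous_const).intervalIntegrable _ _)
    refine Filter.Eventually.of_forall fun y hy => ?_
    rw [Real.norm_eq_abs, abs_mul]
    exact mul_le_mul_of_nonneg_left (hΓ y ⟨hy.1.le, hy.2.trans hx.2⟩) (abs_nonneg _)
  rw [gFun_dotProduct]
  have h2 := abs_sub (gam A a K x ⬝ᵥ v)
    (∫ y in (0 : ℝ)..x, kernelQ a c x y * (gam A a K y ⬝ᵥ v))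
  have h3 := hΓ x hx
  linarith

/-- `∫₀ˣ (x² - y²)ᵐ dy = 4ᵐ (m!)² x^{2m+1} / (2m+1)!`. -/
theorem integral_sq_sub_sq_pow (x : ℝ) (m : ℕ) :
    (∫ y in (0 : ℝ)..x, (x ^ 2 - y ^ 2) ^ m) * ((2 * m + 1).factorial : ℝ) =
      x ^ (2 * m + 1) * 4 ^ m * (m.factorial : ℝ) ^ 2 := by
  induction m with
  | zero => simp
  | succ m ih =>
    have hd : ∀ y ∈ uIcc 0 x, HasDerivAt (fun y : ℝ => y * (x ^ 2 - y ^ 2) ^ (m + 1))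
        ((2 * m + 3) * (x ^ 2 - y ^ 2) ^ (m + 1)
          - (2 * (m + 1) * x ^ 2) * (x ^ 2 - y ^ 2) ^ m) y := by
      intro y _
      have h1 : HasDerivAt (fun y : ℝ => x ^ 2 - y ^ 2) (-(2 * y)) y := by
        simpa using ((hasDerivAt_id y).fun_pow 2).const_sub (x ^ 2)
      refine ((hasDerivAt_id y).fun_mul (h1.fun_pow (m + 1))).congr_deriv ?_
      simp only [id, add_tsub_cancel_right]
      push_cast
      ring
    have h1 := intervalIntegral.integral_eq_sub_of_hasDerivAt hd
      (Continuous.intervalIntegrable (by fun_prop) _ _)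
    rw [intervalIntegral.integral_sub (Continuous.intervalIntegrable (by fun_prop) _ _)
      (Continuous.intervalIntegrable (by fun_prop) _ _), intervalIntegral.integral_const_mul,
      intervalIntegral.integral_const_mul] at h1
    simp only [sub_self, ne_eq, Nat.add_eq_zero_iff, one_ne_zero, and_false, not_false_eq_true,
      zero_pow, mul_zero, zero_mul] at h1
    have h2 : ((2 * (m + 1) + 1).factorial : ℝ) =
        (2 * m + 3) * ((2 * m + 2) * ((2 * m + 1).factorial : ℝ)) := by
      rw [show 2 * (m + 1) + 1 = (2 * m + 1 + 1) + 1 by ring, Nat.factorial_succ,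
        Nat.factorial_succ]
      push_cast
      ring
    have h3 : ((m + 1).factorial : ℝ) = (m + 1) * (m.factorial : ℝ) := by
      rw [Nat.factorial_succ]
      push_cast
      ring
    rw [h2, h3]
    generalize ((2 * m + 1).factorial : ℝ) = F at ih ⊢
    linear_combination ((2 * m + 2) * F) * h1
      + (2 * (m + 1) * x ^ 2) * (2 * m + 2) * ih

/-- The total mass of the kernel `|q(x,·)|`: for `a + c = σ²` it is `cosh(σx) - 1`. -/
theorem integral_abs_kernelQ {a c σ x : ℝ} (hσ : a + c = σ ^ 2) (hx : 0 ≤ x) :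
    ∫ y in (0 : ℝ)..x, |kernelQ a c x y| = Real.cosh (σ * x) - 1 := by
  set T : ℕ → ℝ → ℝ := fun m y => σ ^ 2 * x *
    ((σ ^ 2 * (x ^ 2 - y ^ 2) / 4) ^ m / (2 * (m.factorial : ℝ) * ((m + 1).factorial : ℝ)))
    with hT
  have hfac : ∀ m : ℕ, (0 : ℝ) < m.factorial := fun m => by exact_mod_cast m.factorial_pos
  have hy : ∀ y ∈ uIoc (0 : ℝ) x, 0 ≤ x ^ 2 - y ^ 2 ∧ x ^ 2 - y ^ 2 ≤ x ^ 2 := by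
    intro y hy
    rw [uIoc_of_le hx] at hy
    constructor <;> nlinarith [hy.1, hy.2]
  have hTsum : ∀ y, HasSum (fun m => T m y)
      (σ ^ 2 * x * besselI1Quot ((a + c) * (x ^ 2 - y ^ 2))) := by
    intro y
    rw [hσ]
    exact ((summable_besselI1Quot_bound _).hasSum).mul_left _
  have h1 : HasSum (fun m => ∫ y in (0 : ℝ)..x, T m y)
      (∫ y in (0 : ℝ)..x, |kernelQ a c x y|) := by
    refine intervalIntegral.hasSum_integral_of_dominated_convergence
      (fun m _ => σ ^ 2 * x *
        ((σ ^ 2 * x ^ 2 / 4) ^ m / (2 * (m.factorial : ℝ) * ((m + 1).factorial : ℝ))))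
      (fun m => ?_) (fun m => ?_) ?_ ?_ ?_
    · refine Continuous.aestronglyMeasurable ?_
      simp only [hT]
      fun_prop
    · refine Filter.Eventually.of_forall fun y hy1 => ?_
      obtain ⟨h1, h2⟩ := hy y hy1
      rw [Real.norm_eq_abs, abs_of_nonneg (by positivity)]
      simp only [hT]
      gcongr
    · exact Filter.Eventually.of_forall fun y _ =>
        (summable_besselI1Quot_bound _).mul_left _
    · exact intervalIntegrable_const
    · refine Filter.Eventually.of_forall fun y hy1 => ?_
      obtain ⟨h1, h2⟩ := hy y hy1
      have hnn : 0 ≤ σ ^ 2 * x * besselI1Quot ((a + c) * (x ^ 2 - y ^ 2)) := by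
        refine (hTsum y).nonneg fun m => ?_
        positivity
      have h3 : |kernelQ a c x y| = σ ^ 2 * x * besselI1Quot ((a + c) * (x ^ 2 - y ^ 2)) := by
        rw [kernelQ, neg_mul, neg_mul, abs_neg, ← abs_of_nonneg hnn]
        rw [hσ]
      rw [h3]
      exact hTsum y
  have heq : ∀ m, ∫ y in (0 : ℝ)..x, T m y =
      (σ * x) ^ (2 * (m + 1)) / ((2 * (m + 1)).factorial : ℝ) := by
    intro m
    have h4 := integral_sq_sub_sq_pow x m
    have h5 : (fun y => T m y) = fun y => (σ ^ 2 * x * ((σ ^ 2 / 4) ^ m /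
        (2 * (m.factorial : ℝ) * ((m + 1).factorial : ℝ)))) * (x ^ 2 - y ^ 2) ^ m := by
      funext y
      simp only [hT]
      rw [mul_div_right_comm, mul_pow]
      ring
    have h6 : ((2 * (m + 1)).factorial : ℝ) = (2 * m + 2) * ((2 * m + 1).factorial : ℝ) := by
      rw [show 2 * (m + 1) = (2 * m + 1) + 1 by ring, Nat.factorial_succ]
      push_cast
      ring
    have h7 : ((m + 1).factorial : ℝ) = (m + 1) * (m.factorial : ℝ) := by
      rw [Nat.factorial_succ]
      push_cast
      ring
    have h9 := hfac (2 * m + 1)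
    rw [h5, intervalIntegral.integral_const_mul, eq_div_of_mul_eq h9.ne' h4, h6, h7]
    have h10 : σ ^ (2 * (m + 1)) = σ ^ 2 * (σ ^ 2) ^ m := by rw [pow_mul, pow_succ]; ring
    have h11 : x ^ (2 * (m + 1)) = x * x ^ (2 * m + 1) := by ring
    rw [div_pow, mul_pow, h10, h11]
    field_simp
  have h2 : HasSum (fun m => ∫ y in (0 : ℝ)..x, T m y) (Real.cosh (σ * x) - 1) := by
    have h3 := (hasSum_nat_add_iff' 1).mpr (Real.hasSum_cosh (σ * x))
    simp only [Finset.sum_range_one, mul_zero, pow_zero, Nat.factorial_zero, Nat.cast_one,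
      div_one] at h3
    simpa only [heq] using h3
  exact h1.unique h2

theorem abs_dotProduct_le {n : ℕ} (u v : Fin n → ℝ) :
    |u ⬝ᵥ v| ≤ Real.sqrt (u ⬝ᵥ u) * Real.sqrt (v ⬝ᵥ v) := by
  rw [← Real.sqrt_mul (dotProduct_self_nonneg u)]
  exact Real.abs_le_sqrt (dotProduct_sq_le u v)

theorem bddAbove_norm_gam {n : ℕ} (A : Matrix (Fin n) (Fin n) ℝ) (a : ℝ)
    (K : Matrix (Fin 1) (Fin n) ℝ) :
    BddAbove ((fun x : ℝ => Real.sqrt (gam A a K x ⬝ᵥ gam A a K x)) '' Icc (0 : ℝ) 1) := by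
  have hγ := continuous_gam A a K
  exact isCompact_Icc.bddAbove_image (Continuous.continuousOn (by fun_prop))

/-- The bound by `ζ` on the coupling term of the heat equation. -/
theorem gFun_dotProduct_sq_le_zeta {n : ℕ} (A : Matrix (Fin n) (Fin n) ℝ) (a : ℝ)
    (K : Matrix (Fin 1) (Fin n) ℝ) (c : ℝ) {x : ℝ} (hx : x ∈ Icc (0 : ℝ) 1) (v : Fin n → ℝ) :
    (gFun A a K c x ⬝ᵥ v) ^ 2 ≤ zeta A a K c * (v ⬝ᵥ v) := by
  set G := sSup ((fun x : ℝ => Real.sqrt (gam A a K x ⬝ᵥ gam A a K x)) '' Icc (0 : ℝ) 1)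
  set Q := sSup ((fun p : ℝ × ℝ => |kernelQ a c p.1 p.2|) ''
      {p : ℝ × ℝ | 0 ≤ p.2 ∧ p.2 ≤ p.1 ∧ p.1 ≤ 1})
  have hqc := continuous_kernelQ a c
  have hcpt : IsCompact {p : ℝ × ℝ | 0 ≤ p.2 ∧ p.2 ≤ p.1 ∧ p.1 ≤ 1} := by
    refine (isCompact_Icc (a := ((0, 0) : ℝ × ℝ)) (b := (1, 1))).of_isClosed_subset ?_ ?_
    · exact (isClosed_le continuous_const continuous_snd).inter
        ((isClosed_le continuous_snd continuous_fst).inter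
          (isClosed_le continuous_fst continuous_const))
    · rintro ⟨p, q⟩ ⟨h1, h2, h3⟩
      exact ⟨⟨h1.trans h2, h1⟩, ⟨h3, h2.trans h3⟩⟩
  have hG1 : ∀ y ∈ Icc (0 : ℝ) 1, Real.sqrt (gam A a K y ⬝ᵥ gam A a K y) ≤ G := fun y hy =>
    le_csSup (bddAbove_norm_gam A a K) ⟨y, hy, rfl⟩
  have hQ1 : ∀ y ∈ Icc (0 : ℝ) x, |kernelQ a c x y| ≤ Q := fun y hy =>
    le_csSup (hcpt.bddAbove_image hqc.abs.continuousOn) ⟨(x, y), ⟨hy.1, hy.2, hx.2⟩, rfl⟩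
  have hG0 : 0 ≤ G := (Real.sqrt_nonneg _).trans (hG1 x hx)
  have hQ0 : 0 ≤ Q := (abs_nonneg _).trans (hQ1 0 ⟨le_rfl, hx.1⟩)
  have h1 := abs_gFun_dotProduct_le A a K c hx (v := v) (Γ := G * Real.sqrt (v ⬝ᵥ v))
    fun y hy => (abs_dotProduct_le _ _).trans
      (mul_le_mul_of_nonneg_right (hG1 y hy) (Real.sqrt_nonneg _))
  have h2 : ∫ y in (0 : ℝ)..x, |kernelQ a c x y| ≤ Q := by
    have hq : Continuous fun y : ℝ => |kernelQ a c x y| :=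
      (hqc.comp (by fun_prop : Continuous fun y : ℝ => (x, y))).abs
    have h3 := intervalIntegral.integral_mono_on hx.1 (hq.intervalIntegrable 0 x)
      (intervalIntegrable_const (c := Q) (μ := volume)) hQ1
    rw [intervalIntegral.integral_const, smul_eq_mul, sub_zero] at h3
    nlinarith [hx.2]
  have h3 : |gFun A a K c x ⬝ᵥ v| ≤ (1 + Q) * (G * Real.sqrt (v ⬝ᵥ v)) :=
    h1.trans (mul_le_mul_of_nonneg_right (by linarith)
      (mul_nonneg hG0 (Real.sqrt_nonneg _)))
  calc (gFun A a K c x ⬝ᵥ v) ^ 2 = |gFun A a K c x ⬝ᵥ v| ^ 2 := (sq_abs _).symm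
    _ ≤ ((1 + Q) * (G * Real.sqrt (v ⬝ᵥ v))) ^ 2 := by gcongr
    _ = (1 + Q) ^ 2 * G ^ 2 * Real.sqrt (v ⬝ᵥ v) ^ 2 := by ring
    _ = zeta A a K c * (v ⬝ᵥ v) := by rw [Real.sq_sqrt (dotProduct_self_nonneg v)]; rfl

/-- The growth of `g` in `x` is at most that of `e^{σx}`, `σ² = a + c`, with a constant that does
not depend on `c`. -/
theorem exists_abs_gFun_dotProduct_le_exp {n : ℕ} (A : Matrix (Fin n) (Fin n) ℝ) (a : ℝ)
    (K : Matrix (Fin 1) (Fin n) ℝ) : ∃ Γ : ℝ, 0 ≤ Γ ∧ ∀ c σ : ℝ, 0 ≤ σ → a + c = σ ^ 2 →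
      ∀ x ∈ Icc (0 : ℝ) 1, ∀ v : Fin n → ℝ,
        |gFun A a K c x ⬝ᵥ v| ≤ Real.exp (σ * x) * (Γ * Real.sqrt (v ⬝ᵥ v)) := by
  set G := sSup ((fun x : ℝ => Real.sqrt (gam A a K x ⬝ᵥ gam A a K x)) '' Icc (0 : ℝ) 1)
  have hG1 : ∀ y ∈ Icc (0 : ℝ) 1, Real.sqrt (gam A a K y ⬝ᵥ gam A a K y) ≤ G := fun y hy =>
    le_csSup (bddAbove_norm_gam A a K) ⟨y, hy, rfl⟩
  have hG0 : 0 ≤ G := (Real.sqrt_nonneg _).trans (hG1 0 ⟨le_rfl, zero_le_one⟩)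
  refine ⟨G, hG0, fun c σ hσ hc x hx v => ?_⟩
  have h1 := abs_gFun_dotProduct_le A a K c hx (v := v) (Γ := G * Real.sqrt (v ⬝ᵥ v))
    fun y hy => (abs_dotProduct_le _ _).trans
      (mul_le_mul_of_nonneg_right (hG1 y hy) (Real.sqrt_nonneg _))
  rw [integral_abs_kernelQ hc hx.1, add_sub_cancel] at h1
  have h2 : Real.cosh (σ * x) ≤ Real.exp (σ * x) := by
    have h3 : Real.exp (-(σ * x)) ≤ Real.exp (σ * x) :=
      Real.exp_le_exp.mpr (by nlinarith [mul_nonneg hσ hx.1])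
    rw [Real.cosh_eq]
    linarith
  exact h1.trans (mul_le_mul_of_nonneg_right h2 (mul_nonneg hG0 (Real.sqrt_nonneg _)))

/-! ### Calculus in the Sobolev space -/

/-- The Lebesgue measure on `(0,1)`. -/
abbrev vol01 : Measure ℝ := volume.restrict (Ioo (0 : ℝ) 1)

/-- An `H¹` function has an absolutely continuous representative, which is differentiable a.e.
with the weak derivative as its derivative, and whose values are those of `pointValue`. -/
theorem HasDerivL2.exists_absolutelyContinuous {u v : L2} (h : HasDerivL2 u v) :
    ∃ f : ℝ → ℝ, AbsolutelyContinuousOnInterval f 0 1 ∧ (∀ᵐ x ∂vol01, u x = f x) ∧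
      (∀ᵐ x ∂vol01, HasDerivAt f (v x) x) ∧ ∀ x ∈ Icc (0 : ℝ) 1, pointValue u v x = f x := by
  obtain ⟨b, hb⟩ := h
  have h0 : (0 : ℝ) ∈ uIcc (0 : ℝ) 1 := by simp
  have hv : IntervalIntegrable v volume 0 1 :=
    L2.intervalIntegrable v ⟨le_rfl, zero_le_one⟩ ⟨zero_le_one, le_rfl⟩
  refine ⟨fun x => b + ∫ y in (0 : ℝ)..x, v y, ?_, hb, ?_, fun x hx => pointValue_eq hb hx⟩
  · have hc : AbsolutelyContinuousOnInterval (fun _ : ℝ => b) 0 1 :=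
      (contDiff_const (c := b)).contDiffOn.absolutelyContinuousOnInterval
    exact hc.add (hv.absolutelyContinuousOnInterval_intervalIntegral h0)
  · filter_upwards [ae_restrict_of_ae hv.ae_hasDerivAt_integral, ae_restrict_mem measurableSet_Ioo]
      with x hx hx1
    have hxm : x ∈ uIcc (0 : ℝ) 1 := by
      rw [uIcc_of_le zero_le_one]
      exact Ioo_subset_Icc_self hx1
    exact (hx hxm 0 h0).const_add b

/-- Integration of the derivative of a product of two `H¹` functions and a smooth weight. -/
theorem integral_deriv_weight_mul {u u' v v' : L2} (hu : HasDerivL2 u u') (hv : HasDerivL2 v v')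
    {ω ω' : ℝ → ℝ} (hω : ContDiff ℝ 1 ω) (hω' : ∀ x, HasDerivAt ω (ω' x) x) :
    ∫ x, (ω' x * (u x * v x) + ω x * (u' x * v x + u x * v' x)) ∂vol01 =
      ω 1 * (pointValue u u' 1 * pointValue v v' 1)
        - ω 0 * (pointValue u u' 0 * pointValue v v' 0) := by
  obtain ⟨f, hf, hfu, hfd, hfp⟩ := hu.exists_absolutelyContinuous
  obtain ⟨g, hg, hgv, hgd, hgp⟩ := hv.exists_absolutelyContinuous
  have hac : AbsolutelyContinuousOnInterval (fun x => ω x * (f x * g x)) 0 1 :=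
    (hω.contDiffOn.absolutelyContinuousOnInterval).fun_mul (hf.fun_mul hg)
  have h1 := hac.integral_deriv_eq_sub
  rw [hfp 1 ⟨zero_le_one, le_rfl⟩, hfp 0 ⟨le_rfl, zero_le_one⟩,
    hgp 1 ⟨zero_le_one, le_rfl⟩, hgp 0 ⟨le_rfl, zero_le_one⟩, ← h1,
    intervalIntegral.integral_of_le zero_le_one, integral_Ioc_eq_integral_Ioo]
  refine integral_congr_ae ?_
  filter_upwards [hfu, hfd, hgv, hgd] with x h1 h2 h3 h4
  rw [((hω' x).fun_mul (h2.fun_mul h4)).deriv, h1, h3]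

theorem L2.inner_eq_integral (u v : L2) : inner ℝ u v = ∫ x, u x * v x ∂vol01 := by
  rw [MeasureTheory.L2.inner_def]
  refine integral_congr_ae (Filter.Eventually.of_forall fun x => ?_)
  simp [mul_comm]

theorem L2.integrable_mul (u v : L2) : Integrable (fun x => u x * v x) vol01 :=
  (Lp.memLp u).integrable_mul (Lp.memLp v)

theorem L2.integrable_weight_mul {ω : ℝ → ℝ} (hω : Continuous ω) (u v : L2) :
    Integrable (fun x => ω x * (u x * v x)) vol01 := by
  obtain ⟨C, hC⟩ := isCompact_Icc.exists_bound_of_continuousOn (s := Icc (0 : ℝ) 1)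
    hω.continuousOn
  refine (L2.integrable_mul u v).bdd_mul (c := C) hω.aestronglyMeasurable ?_
  filter_upwards [ae_restrict_mem measurableSet_Ioo] with x hx
  exact hC x (Ioo_subset_Icc_self hx)

theorem memLp_top_exp (μ : ℝ) : MemLp (fun x : ℝ => Real.exp (-μ * x)) ⊤ vol01 := by
  refine memLp_top_of_bound (C := Real.exp |μ|) (by fun_prop) ?_
  filter_upwards [ae_restrict_mem measurableSet_Ioo] with x hx
  rw [Real.norm_eq_abs, Real.abs_exp, Real.exp_le_exp]
  have := neg_abs_le μ
  have := abs_nonneg μ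
  nlinarith [hx.1, hx.2]

/-- Multiplication by the exponential weight `e^{-μx}`, as an operator on `L²(0,1)`. -/
def expMul (μ : ℝ) : L2 →L[ℝ] L2 :=
  (ContinuousLinearMap.mul ℝ ℝ).holderL vol01 ⊤ 2 2 (memLp_top_exp μ).toLp

theorem expMul_coeFn (μ : ℝ) (u : L2) :
    ∀ᵐ x ∂vol01, expMul μ u x = Real.exp (-μ * x) * u x := by
  filter_upwards [ContinuousLinearMap.coeFn_holder (r := 2) (ContinuousLinearMap.mul ℝ ℝ)
    (memLp_top_exp μ).toLp u, (memLp_top_exp μ).coeFn_toLp] with x hx hx2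
  change (ContinuousLinearMap.mul ℝ ℝ).holder 2 _ u x = _
  rw [hx, hx2]
  rfl

theorem expMul_zero (u : L2) : expMul 0 u = u := by
  refine Lp.ext ?_
  filter_upwards [expMul_coeFn 0 u] with x hx
  simp [hx]

theorem inner_expMul (μ : ℝ) (u v : L2) :
    inner ℝ (expMul μ u) (expMul μ v) = ∫ x, Real.exp (-2 * μ * x) * (u x * v x) ∂vol01 := by
  rw [L2.inner_eq_integral]
  refine integral_congr_ae ?_
  filter_upwards [expMul_coeFn μ u, expMul_coeFn μ v] with x hu hv
  have h1 : Real.exp (-2 * μ * x) = Real.exp (-μ * x) * Real.exp (-μ * x) := by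
    rw [← Real.exp_add]
    ring_nf
  rw [hu, hv, h1]
  ring

theorem integrable_deriv_weight_mul (u u' v v' : L2) {ω ω' : ℝ → ℝ} (hω : Continuous ω)
    (hω' : Continuous ω') :
    Integrable (fun x => ω' x * (u x * v x) + ω x * (u' x * v x + u x * v' x)) vol01 := by
  simp only [mul_add]
  exact (L2.integrable_weight_mul hω' u v).add
    ((L2.integrable_weight_mul hω u' v).add (L2.integrable_weight_mul hω u v'))

theorem norm_sq_eq_integral (u : L2) : ‖u‖ ^ 2 = ∫ x, u x * u x ∂vol01 := by
  rw [← L2.inner_eq_integral, real_inner_self_eq_norm_sq]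

theorem hasDerivAt_exp_mul (k x : ℝ) :
    HasDerivAt (fun x : ℝ => Real.exp (k * x)) (k * Real.exp (k * x)) x := by
  have h1 : HasDerivAt (fun x : ℝ => k * x) k x := by
    simpa using (hasDerivAt_id x).const_mul k
  exact h1.exp.congr_deriv (mul_comm _ _)

/-- Integration by parts `⟨u_x, v_x⟩ = -⟨u, v_xx⟩` for `v` with Neumann boundary values. -/
theorem H2.inner_dx_dx (u v : H2) (h0 : v.dxAt 0 = 0) (h1 : v.dxAt 1 = 0) :
    inner ℝ u.dx v.dx = -inner ℝ u.fn v.dxx := by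
  have h := integral_deriv_weight_mul u.2.1 v.2.2 (ω := fun _ => 1) (ω' := fun _ => 0)
    contDiff_const (fun x => hasDerivAt_const x 1)
  change pointValue v.dx v.dxx 0 = 0 at h0
  change pointValue v.dx v.dxx 1 = 0 at h1
  change ∫ x, ((0 : ℝ) * (u.fn x * v.dx x) + 1 * (u.dx x * v.dx x + u.fn x * v.dxx x)) ∂vol01 =
    1 * (pointValue u.fn u.dx 1 * pointValue v.dx v.dxx 1)
      - 1 * (pointValue u.fn u.dx 0 * pointValue v.dx v.dxx 0) at h
  simp only [zero_mul, zero_add, one_mul] at h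
  rw [h0, h1, integral_add (L2.integrable_mul _ _) (L2.integrable_mul _ _),
    ← L2.inner_eq_integral, ← L2.inner_eq_integral] at h
  linarith

/-- The weighted diffusion term: with `y = e^{-μx} z`, it is `μ²‖y‖² - ‖y_x‖²`. The boundary
terms that the weight creates cancel. -/
theorem H2.inner_expMul_fn_dxx (μ : ℝ) (z : H2) (h0 : z.dxAt 0 = 0) (h1 : z.dxAt 1 = 0) :
    inner ℝ (expMul μ z.fn) (expMul μ z.dxx) =
      μ ^ 2 * ‖expMul μ z.fn‖ ^ 2 - ‖expMul μ z.dx - μ • expMul μ z.fn‖ ^ 2 := by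
  have h := integral_deriv_weight_mul z.2.1 z.2.2
    (ω := fun x => Real.exp (-2 * μ * x)) (ω' := fun x => -2 * μ * Real.exp (-2 * μ * x))
    (by fun_prop) (fun x => hasDerivAt_exp_mul (-2 * μ) x)
  change pointValue z.dx z.dxx 0 = 0 at h0
  change pointValue z.dx z.dxx 1 = 0 at h1
  change ∫ x, (-2 * μ * Real.exp (-2 * μ * x) * (z.fn x * z.dx x)
      + Real.exp (-2 * μ * x) * (z.dx x * z.dx x + z.fn x * z.dxx x)) ∂vol01 =
    Real.exp (-2 * μ * 1) * (pointValue z.fn z.dx 1 * pointValue z.dx z.dxx 1)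
      - Real.exp (-2 * μ * 0) * (pointValue z.fn z.dx 0 * pointValue z.dx z.dxx 0) at h
  have hc : Continuous fun x : ℝ => Real.exp (-2 * μ * x) := by fun_prop
  have h2 : ∫ x, (-2 * μ * Real.exp (-2 * μ * x) * (z.fn x * z.dx x)
      + Real.exp (-2 * μ * x) * (z.dx x * z.dx x + z.fn x * z.dxx x)) ∂vol01 =
      -2 * μ * inner ℝ (expMul μ z.fn) (expMul μ z.dx)
        + (inner ℝ (expMul μ z.dx) (expMul μ z.dx)
          + inner ℝ (expMul μ z.fn) (expMul μ z.dxx)) := by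
    rw [inner_expMul, inner_expMul, inner_expMul, ← integral_const_mul, ← integral_add,
      ← integral_add]
    · simp only [mul_add, mul_assoc]
    · exact (L2.integrable_weight_mul hc _ _).const_mul _
    · exact (L2.integrable_weight_mul hc _ _).add (L2.integrable_weight_mul hc _ _)
    · exact L2.integrable_weight_mul hc _ _
    · exact L2.integrable_weight_mul hc _ _
  rw [h2, h0, h1] at h
  rw [norm_sub_sq_real, inner_smul_right, norm_smul, mul_pow, Real.norm_eq_abs, sq_abs,
    real_inner_comm (expMul μ z.fn) (expMul μ z.dx),
    ← real_inner_self_eq_norm_sq (expMul μ z.dx)]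
  linarith

/-- The trace inequality `z(0)² ≤ 2‖y‖² + ‖y_x‖²`, where `y = e^{-μx} z`. -/
theorem H2.pt_zero_sq_le (μ : ℝ) (z : H2) :
    z.pt 0 ^ 2 ≤ 2 * ‖expMul μ z.fn‖ ^ 2 + ‖expMul μ z.dx - μ • expMul μ z.fn‖ ^ 2 := by
  set y : L2 := expMul μ z.dx - μ • expMul μ z.fn with hy
  have hc : Continuous fun x : ℝ => (1 - x) * Real.exp (-2 * μ * x) := by fun_prop
  have hc' : Continuous fun x : ℝ =>
      -1 * Real.exp (-2 * μ * x) + (1 - x) * (-2 * μ * Real.exp (-2 * μ * x)) := by fun_prop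
  -- The weight `1 - x` removes the boundary value at `x = 1`.
  have h := integral_deriv_weight_mul z.2.1 z.2.1
    (ω := fun x => (1 - x) * Real.exp (-2 * μ * x))
    (ω' := fun x => -1 * Real.exp (-2 * μ * x) + (1 - x) * (-2 * μ * Real.exp (-2 * μ * x)))
    (by fun_prop)
    (fun x => ((hasDerivAt_id x).const_sub 1).mul (hasDerivAt_exp_mul (-2 * μ) x))
  simp only [sub_self, zero_mul, mul_zero, Real.exp_zero, sub_zero, mul_one, one_mul,
    zero_sub] at h
  have hint := integrable_deriv_weight_mul z.fn z.dx z.fn z.dx hc hc'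
  have h2 : ∫ x, -((-1 * Real.exp (-2 * μ * x) + (1 - x) * (-2 * μ * Real.exp (-2 * μ * x)))
        * (z.fn x * z.fn x)
      + (1 - x) * Real.exp (-2 * μ * x) * (z.dx x * z.fn x + z.fn x * z.dx x)) ∂vol01 ≤
      ∫ x, (2 * (expMul μ z.fn x * expMul μ z.fn x) + y x * y x) ∂vol01 := by
    refine integral_mono_ae hint.neg
      (((L2.integrable_mul _ _).const_mul 2).add (L2.integrable_mul _ _)) ?_
    filter_upwards [ae_restrict_mem measurableSet_Ioo, expMul_coeFn μ z.fn, expMul_coeFn μ z.dx,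
      Lp.coeFn_sub (expMul μ z.dx) (μ • expMul μ z.fn), Lp.coeFn_smul μ (expMul μ z.fn)]
      with x hx h1 h2 h3 h4
    rw [hy, h3, Pi.sub_apply, h4, Pi.smul_apply, smul_eq_mul, h1, h2]
    have h5 : Real.exp (-2 * μ * x) = Real.exp (-μ * x) * Real.exp (-μ * x) := by
      rw [← Real.exp_add]
      ring_nf
    rw [h5]
    set e := Real.exp (-μ * x)
    set u := e * z.fn x
    set w := e * z.dx x - μ * u
    have h6 : -((-1 * (e * e) + (1 - x) * (-2 * μ * (e * e))) * (z.fn x * z.fn x)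
        + (1 - x) * (e * e) * (z.dx x * z.fn x + z.fn x * z.dx x))
        = u * u - 2 * (1 - x) * (u * w) := by
      simp only [w, u]
      ring
    have h7 : 0 ≤ x * (2 - x) := mul_nonneg hx.1.le (by linarith [hx.2])
    refine h6.trans_le ?_
    nlinarith [sq_nonneg (w + (1 - x) * u), mul_nonneg h7 (mul_self_nonneg u)]
  rw [integral_neg, integral_add ((L2.integrable_mul _ _).const_mul 2) (L2.integrable_mul _ _),
    integral_const_mul, ← norm_sq_eq_integral, ← norm_sq_eq_integral] at h2
  have h3 : z.pt 0 ^ 2 = pointValue z.1.1 z.1.2.1 0 * pointValue z.1.1 z.1.2.1 0 := sq _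
  rw [h3]
  change -_ ≤ _ at h2
  refine le_trans (le_of_eq ?_) h2
  change _ = -∫ x, ((-1 * Real.exp (-2 * μ * x) + (1 - x) * (-2 * μ * Real.exp (-2 * μ * x)))
        * (z.1.1 x * z.1.1 x)
      + (1 - x) * Real.exp (-2 * μ * x) * (z.1.2.1 x * z.1.1 x + z.1.1 x * z.1.2.1 x)) ∂vol01
  rw [h, neg_neg]

/-- Wirtinger's inequality for `z_x`, which vanishes at both ends, with a constant that suffices
here. If `ω' - ω² ≥ k`, completing the square in `0 = ∫ (ω z_x²)'` gives
`k ‖z_x‖² ≤ ‖z_xx‖²`; the weight is a cubic. -/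
theorem H2.wirtinger (z : H2) (h0 : z.dxAt 0 = 0) (h1 : z.dxAt 1 = 0) :
    Real.pi ^ 2 / 4 * ‖z.dx‖ ^ 2 ≤ ‖z.dxx‖ ^ 2 := by
  -- `ω = 3s + 8s³` with `s = x - 1/2` satisfies `ω' - ω² ≥ 11/4` on `[0,1]`, and `11/4 > π²/4`.
  have hc : Continuous fun x : ℝ => 3 * (x - 1 / 2) + 8 * (x - 1 / 2) ^ 3 := by fun_prop
  have hc' : Continuous fun x : ℝ => 3 * 1 + 8 * (3 * (x - 1 / 2) ^ 2) := by fun_prop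
  have h := integral_deriv_weight_mul z.2.2 z.2.2
    (ω := fun x => 3 * (x - 1 / 2) + 8 * (x - 1 / 2) ^ 3)
    (ω' := fun x => 3 * 1 + 8 * (3 * (x - 1 / 2) ^ 2)) (by fun_prop)
    (fun x => by
      have hd : HasDerivAt (fun x : ℝ => x - 1 / 2) 1 x := (hasDerivAt_id x).sub_const _
      have hd3 : HasDerivAt (fun x : ℝ => (x - 1 / 2) ^ 3) (3 * (x - 1 / 2) ^ 2) x := by
        simpa using hd.fun_pow 3
      exact (hd.const_mul 3).add (hd3.const_mul 8))
  have e0 : pointValue z.1.2.1 z.1.2.2 0 = 0 := h0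
  have e1 : pointValue z.1.2.1 z.1.2.2 1 = 0 := h1
  rw [e0, e1] at h
  simp only [mul_zero, sub_zero] at h
  have hint := integrable_deriv_weight_mul z.dx z.dxx z.dx z.dxx hc hc'
  have h2 : ∫ x, (11 / 4 : ℝ) * (z.dx x * z.dx x) ∂vol01 ≤
      ∫ x, (z.dxx x * z.dxx x + ((3 * 1 + 8 * (3 * (x - 1 / 2) ^ 2)) * (z.dx x * z.dx x)
        + (3 * (x - 1 / 2) + 8 * (x - 1 / 2) ^ 3)
          * (z.dxx x * z.dx x + z.dx x * z.dxx x))) ∂vol01 := by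
    refine integral_mono_ae ((L2.integrable_mul _ _).const_mul _)
      ((L2.integrable_mul _ _).add hint) ?_
    filter_upwards [ae_restrict_mem measurableSet_Ioo] with x hx
    set t := (x - 1 / 2) ^ 2 with ht
    have ht0 : 0 ≤ t := sq_nonneg _
    have ht1 : t ≤ 1 / 4 := by nlinarith [hx.1, hx.2]
    have h3 : 11 / 4 ≤ 3 * 1 + 8 * (3 * t) - (3 * (x - 1 / 2) + 8 * (x - 1 / 2) ^ 3) ^ 2 := by
      have h4 : (3 * (x - 1 / 2) + 8 * (x - 1 / 2) ^ 3) ^ 2 = t * (3 + 8 * t) ^ 2 := by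
        rw [ht]
        ring
      rw [h4]
      nlinarith [mul_nonneg ht0 (sub_nonneg.mpr ht1), mul_nonneg (mul_nonneg ht0 ht0)
        (sub_nonneg.mpr ht1)]
    set w := 3 * (x - 1 / 2) + 8 * (x - 1 / 2) ^ 3
    have h5 := mul_le_mul_of_nonneg_right h3 (mul_self_nonneg (z.dx x))
    nlinarith [sq_nonneg (z.dxx x + w * z.dx x)]
  have e3 : ∫ x, ((3 * 1 + 8 * (3 * (x - 1 / 2) ^ 2)) * (z.dx x * z.dx x)
        + (3 * (x - 1 / 2) + 8 * (x - 1 / 2) ^ 3)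
          * (z.dxx x * z.dx x + z.dx x * z.dxx x)) ∂vol01 = 0 := h
  rw [integral_add (L2.integrable_mul _ _) hint, e3, integral_const_mul, ← norm_sq_eq_integral,
    ← norm_sq_eq_integral, add_zero] at h2
  have h4 : Real.pi ^ 2 / 4 ≤ 11 / 4 := by nlinarith [Real.pi_lt_d2, Real.pi_pos]
  exact (mul_le_mul_of_nonneg_right h4 (sq_nonneg _)).trans h2

/-! ### Norm estimates in `L²(0,1)` -/

theorem norm_sq_le_of_ae {u : L2} {C : ℝ} (h : ∀ᵐ x ∂vol01, u x * u x ≤ C) : ‖u‖ ^ 2 ≤ C := by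
  rw [norm_sq_eq_integral]
  refine (integral_mono_ae (L2.integrable_mul u u) (integrable_const C) h).trans (le_of_eq ?_)
  simp

/-- A negative definite matrix yields a nonpositive form on vectors with entries in `L²(0,1)`. -/
theorem NegDef.sum_inner_nonpos {ι : Type*} [Fintype ι] {M : Matrix ι ι ℝ} (hM : NegDef M)
    (v : ι → L2) : ∑ i, ∑ j, M i j * inner ℝ (v i) (v j) ≤ 0 := by
  have hint : ∀ i j, Integrable (fun x => M i j * (v i x * v j x)) vol01 := fun i j =>
    (L2.integrable_mul (v i) (v j)).const_mul _
  have h1 : ∑ i, ∑ j, M i j * inner ℝ (v i) (v j) =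
      ∫ x, ∑ i, ∑ j, M i j * (v i x * v j x) ∂vol01 := by
    rw [integral_finsetSum _ fun i _ => integrable_finsetSum _ fun j _ => hint i j]
    refine Finset.sum_congr rfl fun i _ => ?_
    rw [integral_finsetSum _ fun j _ => hint i j]
    refine Finset.sum_congr rfl fun j _ => ?_
    rw [integral_const_mul, L2.inner_eq_integral]
  rw [h1]
  refine integral_nonpos fun x => ?_
  have h2 := hM.posSemidef.dotProduct_mulVec_nonneg (fun i => v i x)
  have h3 : ∑ i, ∑ j, M i j * (v i x * v j x) =
      -(star (fun i => v i x) ⬝ᵥ -M *ᵥ fun i => v i x) := by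
    rw [neg_mulVec, dotProduct_neg, neg_neg]
    simp only [star_trivial, dotProduct, mulVec, Finset.mul_sum]
    exact Finset.sum_congr rfl fun i _ => Finset.sum_congr rfl fun j _ => by ring
  simp only [Pi.zero_apply]
  linarith

theorem NegDef.dotProduct_mulVec_nonpos {ι : Type*} [Fintype ι] {M : Matrix ι ι ℝ}
    (hM : NegDef M) (v : ι → ℝ) : v ⬝ᵥ M *ᵥ v ≤ 0 := by
  have h := hM.posSemidef.dotProduct_mulVec_nonneg v
  rw [star_trivial, neg_mulVec, dotProduct_neg] at h
  linarith

theorem norm_sq_le_exp_mul_norm_expMul_sq {μ : ℝ} (hμ : 0 ≤ μ) (u : L2) :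
    ‖u‖ ^ 2 ≤ Real.exp (2 * μ) * ‖expMul μ u‖ ^ 2 := by
  rw [norm_sq_eq_integral, norm_sq_eq_integral, ← integral_const_mul]
  refine integral_mono_ae (L2.integrable_mul _ _) ((L2.integrable_mul _ _).const_mul _) ?_
  filter_upwards [ae_restrict_mem measurableSet_Ioo, expMul_coeFn μ u] with x hx h1
  have h2 : 1 ≤ Real.exp (2 * μ) * (Real.exp (-μ * x) * Real.exp (-μ * x)) := by
    rw [← Real.exp_add, ← Real.exp_add]
    exact Real.one_le_exp (by nlinarith [hx.1, hx.2])
  rw [h1]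
  nlinarith [mul_le_mul_of_nonneg_right h2 (mul_self_nonneg (u x))]

theorem norm_expMul_sq_le {μ : ℝ} (hμ : 0 ≤ μ) (u : L2) : ‖expMul μ u‖ ^ 2 ≤ ‖u‖ ^ 2 := by
  rw [norm_sq_eq_integral, norm_sq_eq_integral]
  refine integral_mono_ae (L2.integrable_mul _ _) (L2.integrable_mul _ _) ?_
  filter_upwards [ae_restrict_mem measurableSet_Ioo, expMul_coeFn μ u] with x hx h1
  have h2 : Real.exp (-μ * x) * Real.exp (-μ * x) ≤ 1 := by
    rw [← Real.exp_add]
    exact Real.exp_le_one_iff.mpr (by nlinarith [hx.1, hx.2])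
  rw [h1]
  nlinarith [mul_le_mul_of_nonneg_right h2 (mul_self_nonneg (u x))]

theorem abs_two_mul_inner_le (u v : L2) : |2 * inner ℝ u v| ≤ ‖u‖ ^ 2 + ‖v‖ ^ 2 := by
  have h := abs_real_inner_le_norm u v
  rw [abs_mul, abs_two]
  nlinarith [sq_nonneg (‖u‖ - ‖v‖)]

theorem abs_two_mul_inner_le_smul {s : ℝ} (hs : 0 < s) (u v : L2) :
    |2 * inner ℝ u v| ≤ s * ‖u‖ ^ 2 + s⁻¹ * ‖v‖ ^ 2 := by
  have h := abs_real_inner_le_norm u v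
  rw [abs_mul, abs_two]
  have h1 : s * ‖u‖ ^ 2 + s⁻¹ * ‖v‖ ^ 2 - 2 * (‖u‖ * ‖v‖) = s⁻¹ * (s * ‖u‖ - ‖v‖) ^ 2 := by
    field_simp
    ring
  have h2 := mul_nonneg (inv_pos.mpr hs).le (sq_nonneg (s * ‖u‖ - ‖v‖))
  linarith

/-! ### Lyapunov functions along solutions -/

/-- The function `XᵀPX + p₁ ‖e^{-μx} z‖² + p₂ ‖z_x‖²`. -/
def lyap {n : ℕ} (P : Matrix (Fin n) (Fin n) ℝ) (p1 p2 μ : ℝ) (X : Fin n → ℝ) (z : H2) : ℝ :=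
  X ⬝ᵥ P *ᵥ X + p1 * ‖expMul μ z.fn‖ ^ 2 + p2 * ‖z.dx‖ ^ 2

theorem lyap_zero {n : ℕ} (P : Matrix (Fin n) (Fin n) ℝ) (p1 p2 : ℝ) (X : Fin n → ℝ) (z : H2) :
    lyap P p1 p2 0 X z = V1 P p1 p2 X z := by
  rw [lyap, V1, expMul_zero]

theorem lyap_nonneg {n : ℕ} {P : Matrix (Fin n) (Fin n) ℝ} (hP : P.PosDef) {p1 p2 : ℝ}
    (hp1 : 0 ≤ p1) (hp2 : 0 ≤ p2) (μ : ℝ) (X : Fin n → ℝ) (z : H2) : 0 ≤ lyap P p1 p2 μ X z := by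
  have := dotProduct_mulVec_self_nonneg hP X
  unfold lyap
  positivity

theorem continuous_H2_fn : Continuous H2.fn := continuous_fst.comp continuous_subtype_val

theorem continuous_H2_dx : Continuous H2.dx :=
  continuous_fst.comp (continuous_snd.comp continuous_subtype_val)

theorem continuous_H2_dxx : Continuous H2.dxx :=
  continuous_snd.comp (continuous_snd.comp continuous_subtype_val)

theorem continuous_lyap {n : ℕ} (P : Matrix (Fin n) (Fin n) ℝ) (p1 p2 μ : ℝ) :
    Continuous fun Y : (Fin n → ℝ) × H2 => lyap P p1 p2 μ Y.1 Y.2 := by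
  have h1 := continuous_H2_fn
  have h2 := continuous_H2_dx
  unfold lyap
  fun_prop

theorem hasDerivWithinAt_inner_of_eq_zero {f g : ℝ → L2} {f' : L2} {s : Set ℝ} {t : ℝ}
    (hf : HasDerivWithinAt f f' s t) (h0 : f t = 0) (hg : ContinuousWithinAt g s t) :
    HasDerivWithinAt (fun u => inner ℝ (f u) (g u)) (inner ℝ f' (g t)) s t := by
  rw [hasDerivWithinAt_iff_tendsto_slope] at hf ⊢
  have h1 : Filter.Tendsto g (nhdsWithin t (s \ {t})) (nhds (g t)) :=
    hg.mono_left (nhdsWithin_mono t sdiff_subset)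
  refine (hf.inner h1).congr fun u => ?_
  rw [slope_def_module, slope_def_module, h0, inner_zero_left, sub_zero, sub_zero,
    inner_smul_left]
  rfl

/-- Although `z_x` need not be differentiable in time, `‖z_x‖²` is, with derivative
`-2⟨z_t, z_xx⟩`: for Neumann functions,
`‖z_x(s)‖² - ‖z_x(t)‖² = -⟨z(s) - z(t), z_xx(s) + z_xx(t)⟩`. -/
theorem hasDerivWithinAt_norm_dx_sq {z : ℝ → H2} {zt : L2} {s : Set ℝ} {t : ℝ} (ht : t ∈ s)
    (hN : ∀ u ∈ s, (z u).dxAt 0 = 0 ∧ (z u).dxAt 1 = 0)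
    (hz : HasDerivWithinAt (fun u => (z u).fn) zt s t) (hc : ContinuousWithinAt z s t) :
    HasDerivWithinAt (fun u => ‖(z u).dx‖ ^ 2) (-2 * inner ℝ zt (z t).dxx) s t := by
  have hg : ContinuousWithinAt (fun u => (z u).dxx + (z t).dxx) s t :=
    (continuous_H2_dxx.continuousAt.comp_continuousWithinAt hc).add continuousWithinAt_const
  have h1 := hasDerivWithinAt_inner_of_eq_zero (hz.sub_const (z t).fn) (sub_self _) hg
  have h2 := (h1.const_sub (‖(z t).dx‖ ^ 2)).congr_of_mem (f₁ := fun u => ‖(z u).dx‖ ^ 2) ?_ ht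
  · refine h2.congr_deriv ?_
    rw [inner_add_right]
    ring
  · intro u hu
    have e1 := (z u).inner_dx_dx (z u) (hN u hu).1 (hN u hu).2
    have e2 := (z t).inner_dx_dx (z t) (hN t ht).1 (hN t ht).2
    have e3 := (z u).inner_dx_dx (z t) (hN t ht).1 (hN t ht).2
    have e4 := (z t).inner_dx_dx (z u) (hN u hu).1 (hN u hu).2
    have e5 := real_inner_comm (z u).dx (z t).dx
    rw [inner_sub_left, inner_add_right, inner_add_right, ← real_inner_self_eq_norm_sq,
      ← real_inner_self_eq_norm_sq]
    linarith

theorem hasDerivWithinAt_lyap {n : ℕ} {P : Matrix (Fin n) (Fin n) ℝ} (hP : P.PosDef)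
    (p1 p2 μ : ℝ) {X : ℝ → Fin n → ℝ} {X' : Fin n → ℝ} {z : ℝ → H2} {zt : L2} {s : Set ℝ} {t : ℝ}
    (ht : t ∈ s) (hX : HasDerivWithinAt X X' s t)
    (hN : ∀ u ∈ s, (z u).dxAt 0 = 0 ∧ (z u).dxAt 1 = 0)
    (hz : HasDerivWithinAt (fun u => (z u).fn) zt s t) (hc : ContinuousWithinAt z s t) :
    HasDerivWithinAt (fun u => lyap P p1 p2 μ (X u) (z u))
      (2 * (X t ⬝ᵥ P *ᵥ X') + p1 * (2 * inner ℝ (expMul μ (z t).fn) (expMul μ zt))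
        + p2 * (-2 * inner ℝ zt (z t).dxx)) s t := by
  have hPX : HasDerivWithinAt (fun u => P *ᵥ X u) (P *ᵥ X') s t := by
    rw [hasDerivWithinAt_pi]
    intro i
    simp only [mulVec, dotProduct]
    exact HasDerivWithinAt.fun_sum fun j _ => ((hasDerivWithinAt_pi.mp hX) j).const_mul _
  have h1 : HasDerivWithinAt (fun u => X u ⬝ᵥ P *ᵥ X u) (2 * (X t ⬝ᵥ P *ᵥ X')) s t := by
    have h2 : HasDerivWithinAt (fun u => X u ⬝ᵥ P *ᵥ X u)
        (∑ i, (X' i * (P *ᵥ X t) i + X t i * (P *ᵥ X') i)) s t := by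
      simp only [dotProduct]
      exact HasDerivWithinAt.fun_sum fun i _ =>
        ((hasDerivWithinAt_pi.mp hX) i).fun_mul ((hasDerivWithinAt_pi.mp hPX) i)
    refine h2.congr_deriv ?_
    rw [Finset.sum_add_distrib]
    change X' ⬝ᵥ P *ᵥ X t + X t ⬝ᵥ P *ᵥ X' = _
    rw [dotProduct_mulVec_comm hP X']
    ring
  have h2 : HasDerivWithinAt (fun u => ‖expMul μ (z u).fn‖ ^ 2)
      (2 * inner ℝ (expMul μ (z t).fn) (expMul μ zt)) s t :=
    ((expMul μ).hasFDerivAt.comp_hasDerivWithinAt t hz).norm_sq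
  exact (h1.add (h2.const_mul p1)).add ((hasDerivWithinAt_norm_dx_sq ht hN hz hc).const_mul p2)

/-- A dissipation inequality `V' ≤ -2δ₀ V + 2δ₁ V(t - τ)`, checked on states and delayed states,
implies exponential decay along solutions. -/
theorem lyap_le_of_dissipation {n : ℕ} {A A1 : Matrix (Fin n) (Fin n) ℝ}
    {B : Matrix (Fin n) (Fin 1) ℝ} {a a2 : ℝ} {K : Matrix (Fin 1) (Fin n) ℝ} {c : ℝ}
    {P : Matrix (Fin n) (Fin n) ℝ} (hP : P.PosDef) {p1 p2 μ : ℝ} (hp1 : 0 ≤ p1) (hp2 : 0 ≤ p2)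
    {δ δ0 δ1 h : ℝ} (hδ1 : 0 < δ1) (hδ : 0 < δ) (hδeq : δ = δ0 - δ1 * Real.exp (2 * δ * h))
    (hdiss : ∀ (X Xd : Fin n → ℝ) (z zd : H2) (zt w : L2), z.dxAt 0 = 0 → z.dxAt 1 = 0 →
      zt = z.dxx - c • z.fn + a2 • zd.fn - w →
      (∀ᵐ x ∂vol01, w x = gFun A a K c x ⬝ᵥ
        ((A1 - a2 • (1 : Matrix (Fin n) (Fin n) ℝ)) *ᵥ Xd)) →
      2 * (X ⬝ᵥ P *ᵥ ((A + B * K) *ᵥ X + A1 *ᵥ Xd + B *ᵥ fun _ => z.pt 0))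
        + p1 * (2 * inner ℝ (expMul μ z.fn) (expMul μ zt)) + p2 * (-2 * inner ℝ zt z.dxx) ≤
      -2 * δ0 * lyap P p1 p2 μ X z + 2 * δ1 * lyap P p1 p2 μ Xd zd)
    {h0 : ℝ} (hh0 : 0 < h0) {τ : ℝ → ℝ} (hτ : IsDelay h0 h τ) {X : ℝ → Fin n → ℝ} {z : ℝ → H2}
    (hW : InW h X z) (hsol : IsClassicalSolution A A1 B a a2 K c τ X z) {t : ℝ} (ht : 0 ≤ t) :
    lyap P p1 p2 μ (X t) (z t) ≤
      Real.exp (-2 * δ * t) * histSup h (fun θ => lyap P p1 p2 μ (X θ) (z θ)) := by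
  choose! zt hzt hpde using hsol.pde
  have hN : ∀ u ∈ Ici (0 : ℝ), (z u).dxAt 0 = 0 ∧ (z u).dxAt 1 = 0 := hsol.mem_domain
  have hbdd : BddAbove ((fun θ => lyap P p1 p2 μ (X θ) (z θ)) '' Icc (-h) 0) :=
    isCompact_Icc.bddAbove_image
      ((continuous_lyap P p1 p2 μ).comp_continuousOn hW.continuousOn)
  have hS : ∀ θ ∈ Icc (-h) 0, lyap P p1 p2 μ (X θ) (z θ) ≤
      histSup h (fun θ => lyap P p1 p2 μ (X θ) (z θ)) := fun θ hθ =>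
    le_csSup hbdd ⟨θ, hθ, rfl⟩
  have hh : 0 ≤ h := hh0.le.trans ((hτ.2 0 self_mem_Ici).1.trans (hτ.2 0 self_mem_Ici).2)
  have hzc : ContinuousOn z (Ici 0) := continuous_snd.comp_continuousOn hsol.continuousOn
  refine halanay hδ1 hδ hδeq (fun t ht => ⟨hh0.trans_le (hτ.2 t ht).1, (hτ.2 t ht).2⟩)
    (fun t ht => hasDerivWithinAt_lyap hP p1 p2 μ ht (hsol.ode t ht) hN (hzt t ht) (hzc t ht))
    (fun t ht => ?_)
    ((lyap_nonneg hP hp1 hp2 μ (X 0) (z 0)).trans (hS 0 ⟨by linarith, le_rfl⟩)) hS ht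
  refine hdiss (X t) (X (t - τ t)) (z t) (z (t - τ t)) (zt t)
    ((z t).dxx - c • (z t).fn + a2 • (z (t - τ t)).fn - zt t) (hN t ht).1 (hN t ht).2
    (by abel) ?_
  filter_upwards [hpde t ht,
    Lp.coeFn_sub ((z t).dxx - c • (z t).fn + a2 • (z (t - τ t)).fn) (zt t),
    Lp.coeFn_add ((z t).dxx - c • (z t).fn) (a2 • (z (t - τ t)).fn),
    Lp.coeFn_sub (z t).dxx (c • (z t).fn), Lp.coeFn_smul c (z t).fn,
    Lp.coeFn_smul a2 (z (t - τ t)).fn] with x h1 h2 h3 h4 h5 h6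
  rw [h2, Pi.sub_apply, h3, Pi.add_apply, h4, Pi.sub_apply, h5, h6, Pi.smul_apply, Pi.smul_apply,
    h1, smul_eq_mul, smul_eq_mul]
  ring

/-- The heat equation tested with the weighted state and with `z_xx`. -/
theorem inner_heat_equation {μ c a2 : ℝ} {z : H2} (h0 : z.dxAt 0 = 0) (h1 : z.dxAt 1 = 0)
    {u zt w : L2} (hzt : zt = z.dxx - c • z.fn + a2 • u - w) :
    inner ℝ (expMul μ z.fn) (expMul μ zt) = (μ ^ 2 - c) * ‖expMul μ z.fn‖ ^ 2
        - ‖expMul μ z.dx - μ • expMul μ z.fn‖ ^ 2 + a2 * inner ℝ (expMul μ z.fn) (expMul μ u)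
        - inner ℝ (expMul μ z.fn) (expMul μ w) ∧
      inner ℝ zt z.dxx = ‖z.dxx‖ ^ 2 + c * ‖z.dx‖ ^ 2 + a2 * inner ℝ u z.dxx
        - inner ℝ w z.dxx := by
  have e1 := z.inner_expMul_fn_dxx μ h0 h1
  have e2 := z.inner_dx_dx z h0 h1
  rw [real_inner_self_eq_norm_sq] at e2
  rw [hzt]
  constructor
  · rw [map_sub, map_add, map_sub, map_smul, map_smul, inner_sub_right, inner_add_right,
      inner_sub_right, inner_smul_right, inner_smul_right, e1, real_inner_self_eq_norm_sq]
    ring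
  · rw [inner_sub_left, inner_add_left, inner_sub_left, real_inner_smul_left,
      real_inner_smul_left, real_inner_self_eq_norm_sq, e2]
    ring

/-! ### Decay under the linear matrix inequalities -/

/-- The dissipation inequality for `V₁`: the sum of the two matrix inequalities, the scalar
inequality times `‖z_x‖²`, the trace inequality times `λ` and Wirtinger's inequality times
`λ₁`. -/
theorem NeumannLMI.dissipation {n : ℕ} {A A1 : Matrix (Fin n) (Fin n) ℝ}
    {B : Matrix (Fin n) (Fin 1) ℝ} {a a2 : ℝ} {K : Matrix (Fin 1) (Fin n) ℝ}
    {c r r1 δ0 δ1 : ℝ} (hr : 0 < r) (hr1 : 0 < r1) (hδ1 : 0 < δ1)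
    {P : Matrix (Fin n) (Fin n) ℝ} {p1 p2 lam lam1 : ℝ}
    (hL : NeumannLMI A A1 B a a2 K c r r1 δ0 δ1 P p1 p2 lam lam1)
    {X Xd : Fin n → ℝ} {z zd : H2} {zt w : L2} (h0 : z.dxAt 0 = 0) (h1 : z.dxAt 1 = 0)
    (hzt : zt = z.dxx - c • z.fn + a2 • zd.fn - w)
    (hw : ∀ᵐ x ∂vol01, w x = gFun A a K c x ⬝ᵥ
      ((A1 - a2 • (1 : Matrix (Fin n) (Fin n) ℝ)) *ᵥ Xd)) :
    2 * (X ⬝ᵥ P *ᵥ ((A + B * K) *ᵥ X + A1 *ᵥ Xd + B *ᵥ fun _ => z.pt 0))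
        + p1 * (2 * inner ℝ (expMul 0 z.fn) (expMul 0 zt)) + p2 * (-2 * inner ℝ zt z.dxx) ≤
      -2 * δ0 * lyap P p1 p2 0 X z + 2 * δ1 * lyap P p1 p2 0 Xd zd := by
  obtain ⟨e1, e2⟩ := inner_heat_equation (μ := 0) h0 h1 hzt
  have htr := z.pt_zero_sq_le 0
  have hwi := z.wirtinger h0 h1
  simp only [expMul_zero, zero_smul, sub_zero] at e1 htr
  rw [lyap_zero, lyap_zero, expMul_zero, expMul_zero, e1, e2, V1, V1]
  set N : Matrix (Fin n) (Fin n) ℝ := A1 - a2 • (1 : Matrix (Fin n) (Fin n) ℝ) with hN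
  have hwn : ‖w‖ ^ 2 ≤ zeta A a K c * ((N *ᵥ Xd) ⬝ᵥ (N *ᵥ Xd)) := by
    refine norm_sq_le_of_ae ?_
    filter_upwards [hw, ae_restrict_mem measurableSet_Ioo] with x hx hx1
    rw [hx, ← sq]
    exact gFun_dotProduct_sq_le_zeta A a K c (Ioo_subset_Icc_self hx1) _
  have hP := hL.P_posDef
  have t1 := hL.theta1.dotProduct_mulVec_nonpos (Sum.elim X (Sum.elim Xd fun _ => z.pt 0))
  rw [Xi, Rmat, add_mulVec, smul_mulVec, dotProduct_add, dotProduct_smul,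
    dotProduct_symBlock3_mulVec, dotProduct_symBlock3_mulVec] at t1
  have q1 : X ⬝ᵥ ((A + B * K)ᵀ * P) *ᵥ X = X ⬝ᵥ P *ᵥ ((A + B * K) *ᵥ X) := by
    rw [← mulVec_mulVec, dotProduct_mulVec, vecMul_transpose, dotProduct_mulVec_comm hP]
  have q2 : Xd ⬝ᵥ (Nᵀ * N) *ᵥ Xd = (N *ᵥ Xd) ⬝ᵥ (N *ᵥ Xd) := by
    rw [← mulVec_mulVec, dotProduct_mulVec, vecMul_transpose]
  have q3 : (fun _ : Fin 1 => z.pt 0) ⬝ᵥ (fun _ : Fin 1 => z.pt 0) = z.pt 0 ^ 2 := by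
    simp [dotProduct, sq]
  simp only [zero_mulVec, dotProduct_zero, mul_zero, add_zero, zero_add, add_mulVec, smul_mulVec,
    neg_mulVec, dotProduct_add, dotProduct_neg, dotProduct_smul, smul_eq_mul, one_mulVec, q1, q2,
    q3, ← hN] at t1
  simp only [← mulVec_mulVec] at t1
  have t2 := hL.theta2.sum_inner_nonpos ![z.fn, zd.fn, z.dxx]
  simp only [Fin.sum_univ_three] at t2
  simp only [of_apply, cons_val', cons_val_zero, cons_val_fin_one, cons_val_one, cons_val,
    real_inner_self_eq_norm_sq, zero_mul, add_zero, zero_add, real_inner_comm z.fn zd.fn,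
    real_inner_comm zd.fn z.dxx] at t2
  have t3 := mul_le_mul_of_nonneg_right hL.scalar (sq_nonneg ‖z.dx‖)
  have t4 := mul_le_mul_of_nonneg_left htr hL.lam_pos.le
  have t5 := mul_le_mul_of_nonneg_left hwi hL.lam1_nonneg
  have t6 := mul_le_mul_of_nonneg_left
    ((neg_le_abs _).trans (abs_two_mul_inner_le_smul hr z.fn w)) hL.p1_pos.le
  have t7 := mul_le_mul_of_nonneg_left
    ((le_abs_self _).trans (abs_two_mul_inner_le_smul hr1 z.dxx w)) hL.p2_pos.le
  have t8 : 0 ≤ p1 * r⁻¹ + p2 * r1⁻¹ := by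
    have := hL.p1_pos
    have := hL.p2_pos
    positivity
  have t9 := mul_le_mul_of_nonneg_left hwn t8
  have t10 : 0 ≤ δ1 * (p2 * ‖zd.dx‖ ^ 2) :=
    mul_nonneg hδ1.le (mul_nonneg hL.p2_pos.le (sq_nonneg _))
  rw [real_inner_comm w z.dxx] at t7
  simp only [mulVec_add, dotProduct_add, add_mulVec, ← mulVec_mulVec] at t1 ⊢
  linarith

/-- With `δ₁ = δ₀` there is room to decrease `δ₁`: it enters only the two strict matrix
inequalities. -/
theorem NeumannLMI.exists_lt {n : ℕ} {A A1 : Matrix (Fin n) (Fin n) ℝ}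
    {B : Matrix (Fin n) (Fin 1) ℝ} {a a2 : ℝ} {K : Matrix (Fin 1) (Fin n) ℝ} {c r r1 δ0 : ℝ}
    (hδ0 : 0 < δ0) {P : Matrix (Fin n) (Fin n) ℝ} {p1 p2 lam lam1 : ℝ}
    (hL : NeumannLMI A A1 B a a2 K c r r1 δ0 δ0 P p1 p2 lam lam1) :
    ∃ δ1 : ℝ, 0 < δ1 ∧ δ1 < δ0 ∧ NeumannLMI A A1 B a a2 K c r r1 δ0 δ1 P p1 p2 lam lam1 := by
  have hPij : ∀ i j, P i j = P j i := fun i j => by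
    simpa using hL.P_posDef.isHermitian.apply j i
  obtain ⟨ε1, hε1, h1⟩ := exists_posDef_sub_smul hL.theta1
    (N := symBlock3 0 0 0 ((2 : ℝ) • P) 0 0) (by
      ext i j
      rcases i with i | i | i <;> rcases j with j | j | j <;> simp [symBlock3]
      exact hPij _ _)
  obtain ⟨ε2, hε2, h2⟩ := exists_posDef_sub_smul hL.theta2
    (N := !![0, 0, 0; 0, 2 * p1, 0; 0, 0, 0]) (by
      ext i j
      fin_cases i <;> fin_cases j <;> simp)
  set ε := min (min ε1 ε2) (δ0 / 2)
  have hεpos : 0 < ε := lt_min (lt_min hε1 hε2) (by linarith)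
  have hεδ : ε ≤ δ0 / 2 := min_le_right _ _
  refine ⟨δ0 - ε, by linarith, by linarith, hL.P_posDef, hL.p1_pos, hL.p2_pos, hL.lam_pos,
    hL.lam1_nonneg, ?_, ?_, hL.scalar⟩
  · have h3 := h1 ε hεpos.le ((min_le_left _ _).trans (min_le_left _ _))
    rw [NegDef]
    convert h3 using 1
    ext i j
    rcases i with i | i | i <;> rcases j with j | j | j <;> simp [Xi, symBlock3]
    ring
  · have h3 := h2 ε hεpos.le ((min_le_left _ _).trans (min_le_right _ _))
    rw [NegDef]
    convert h3 using 1
    ext i j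
    fin_cases i <;> fin_cases j <;> simp
    ring

theorem NeumannLMI.stableInV1 {n : ℕ} {A A1 : Matrix (Fin n) (Fin n) ℝ}
    {B : Matrix (Fin n) (Fin 1) ℝ} {a a2 : ℝ} {K : Matrix (Fin 1) (Fin n) ℝ}
    {c r r1 δ0 δ1 : ℝ} (hr : 0 < r) (hr1 : 0 < r1) (hδ1 : 0 < δ1) (h01 : δ1 < δ0)
    {P : Matrix (Fin n) (Fin n) ℝ} {p1 p2 lam lam1 : ℝ}
    (hL : NeumannLMI A A1 B a a2 K c r r1 δ0 δ1 P p1 p2 lam lam1) {h δ : ℝ} (hh : 0 < h)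
    (hδ : δ = δ0 - δ1 * Real.exp (2 * δ * h)) : StableInV1 A A1 B a a2 K c P p1 p2 h δ := by
  intro h0 hh0 τ hτ X z hW hsol t ht
  have h1 := lyap_le_of_dissipation (μ := 0) hL.P_posDef hL.p1_pos.le hL.p2_pos.le hδ1
    (halanayRate_pos hδ1 h01 hh hδ) hδ
    (fun X Xd z zd zt w e0 e1 e2 e3 => hL.dissipation hr hr1 hδ1 e0 e1 e2 e3) hh0 hτ hW hsol ht
  simpa only [lyap_zero] using h1

/-! ### Assignment of the decay rate -/

/-- The dissipation inequality for the weighted function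
`XᵀPX + p ‖e^{-μx} z‖² + ε ‖z_x‖²`. The gain of the loop through `g` is measured by `G`, the bound
of the weighted coupling term; it is dominated because `c - μ²` is large. -/
theorem dissipation_of_weight {n : ℕ} {A : Matrix (Fin n) (Fin n) ℝ} {a1 : ℝ}
    {B : Matrix (Fin n) (Fin 1) ℝ} {a a2 : ℝ} {K : Matrix (Fin 1) (Fin n) ℝ}
    {c δ0 δ1 κ μ p r ε G : ℝ} {P : Matrix (Fin n) (Fin n) ℝ} (hP : P.PosDef)
    (hK : ∀ x : Fin n → ℝ, x ⬝ᵥ P *ᵥ ((A + B * K) *ᵥ x) ≤ -κ * (x ⬝ᵥ P *ᵥ x))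
    (hμ : 0 ≤ μ) (hp : 1 ≤ p) (hr : 0 < r) (hε : 0 < ε)
    (hG : ∀ (Xd : Fin n → ℝ) (w : L2), (∀ᵐ x ∂vol01, w x = gFun A a K c x ⬝ᵥ
      ((a1 • (1 : Matrix (Fin n) (Fin n) ℝ) - a2 • (1 : Matrix (Fin n) (Fin n) ℝ)) *ᵥ Xd)) →
      ‖expMul μ w‖ ^ 2 ≤ G * (Xd ⬝ᵥ P *ᵥ Xd))
    (hpB : B.col 0 ⬝ᵥ P *ᵥ B.col 0 ≤ p) (hpr : p * r⁻¹ * G ≤ 1)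
    (hεG : ε * Real.exp (2 * μ) * G ≤ 1) (hεa : ε * Real.exp (2 * μ) * a2 ^ 2 ≤ 1)
    (hκ : 2 * δ0 + |a1| + 1 ≤ 2 * κ) (hδ1 : |a1| + |a2| + 2 ≤ 2 * δ1)
    (hcμ : 2 * δ0 + 2 + |a2| + r ≤ 2 * (c - μ ^ 2)) (hc : δ0 ≤ c)
    {X Xd : Fin n → ℝ} {z zd : H2} {zt w : L2} (h0 : z.dxAt 0 = 0) (h1 : z.dxAt 1 = 0)
    (hzt : zt = z.dxx - c • z.fn + a2 • zd.fn - w)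
    (hw : ∀ᵐ x ∂vol01, w x = gFun A a K c x ⬝ᵥ
      ((a1 • (1 : Matrix (Fin n) (Fin n) ℝ) - a2 • (1 : Matrix (Fin n) (Fin n) ℝ)) *ᵥ Xd)) :
    2 * (X ⬝ᵥ P *ᵥ ((A + B * K) *ᵥ X + (a1 • (1 : Matrix (Fin n) (Fin n) ℝ)) *ᵥ Xd
          + B *ᵥ fun _ => z.pt 0))
        + p * (2 * inner ℝ (expMul μ z.fn) (expMul μ zt)) + ε * (-2 * inner ℝ zt z.dxx) ≤
      -2 * δ0 * lyap P p ε μ X z + 2 * δ1 * lyap P p ε μ Xd zd := by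
  obtain ⟨e1, e2⟩ := inner_heat_equation (μ := μ) h0 h1 hzt
  have htr := z.pt_zero_sq_le μ
  have hB : (B *ᵥ fun _ => z.pt 0) = z.pt 0 • B.col 0 := by
    funext i
    simp [mulVec, dotProduct, Matrix.col, mul_comm]
  rw [e1, e2, lyap, lyap, hB, smul_mulVec, one_mulVec, mulVec_add, mulVec_add, dotProduct_add,
    dotProduct_add]
  simp only [mulVec_smul, dotProduct_smul, smul_eq_mul]
  set q := X ⬝ᵥ P *ᵥ X with hq
  set qd := Xd ⬝ᵥ P *ᵥ Xd
  set Y := ‖expMul μ z.dx - μ • expMul μ z.fn‖ ^ 2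
  set N := ‖expMul μ z.fn‖ ^ 2 with hN
  set Nd := ‖expMul μ zd.fn‖ ^ 2
  have hq0 : 0 ≤ q := dotProduct_mulVec_self_nonneg hP X
  have hqd0 : 0 ≤ qd := dotProduct_mulVec_self_nonneg hP Xd
  have hN0 : 0 ≤ N := sq_nonneg _
  have hNd0 : 0 ≤ Nd := sq_nonneg _
  have hp0 : 0 < p := by linarith
  -- `s1` and `s2` bound the terms that the delay and the trace `z(0)` contribute to `(XᵀPX)'`;
  -- `p` exceeds `BᵀPB`, so that the trace is absorbed by the diffusion term `-2p Y`.
  have s1 : 2 * (a1 * (X ⬝ᵥ P *ᵥ Xd)) ≤ |a1| * (q + qd) := by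
    have h2 := two_mul_dotProduct_mulVec_le hP one_pos X Xd
    have h3 := two_mul_dotProduct_mulVec_le hP one_pos X (-Xd)
    simp only [mulVec_neg, dotProduct_neg, neg_dotProduct, neg_neg, inv_one, one_mul] at h2 h3
    have h4 : |2 * (X ⬝ᵥ P *ᵥ Xd)| ≤ q + qd := abs_le.mpr ⟨by linarith, by linarith⟩
    calc 2 * (a1 * (X ⬝ᵥ P *ᵥ Xd)) = a1 * (2 * (X ⬝ᵥ P *ᵥ Xd)) := by ring
      _ ≤ |a1| * |2 * (X ⬝ᵥ P *ᵥ Xd)| := by rw [← abs_mul]; exact le_abs_self _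
      _ ≤ |a1| * (q + qd) := mul_le_mul_of_nonneg_left h4 (abs_nonneg _)
  have s2 : 2 * (z.pt 0 * (X ⬝ᵥ P *ᵥ B.col 0)) ≤ q + p * (2 * N + Y) := by
    have h2 := two_mul_dotProduct_mulVec_le hP one_pos X (z.pt 0 • B.col 0)
    simp only [mulVec_smul, dotProduct_smul, smul_dotProduct, smul_eq_mul, inv_one, one_mul]
      at h2
    have h3 := mul_le_mul_of_nonneg_left hpB (sq_nonneg (z.pt 0))
    have h4 := mul_le_mul_of_nonneg_left htr hp0.le
    linarith
  have s3 : 2 * (a2 * inner ℝ (expMul μ z.fn) (expMul μ zd.fn)) ≤ |a2| * (N + Nd) := by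
    calc 2 * (a2 * inner ℝ (expMul μ z.fn) (expMul μ zd.fn))
        = a2 * (2 * inner ℝ (expMul μ z.fn) (expMul μ zd.fn)) := by ring
      _ ≤ |a2| * |2 * inner ℝ (expMul μ z.fn) (expMul μ zd.fn)| := by
        rw [← abs_mul]; exact le_abs_self _
      _ ≤ |a2| * (N + Nd) :=
        mul_le_mul_of_nonneg_left (abs_two_mul_inner_le _ _) (abs_nonneg _)
  -- `r` is so large that the coupling term costs at most `qd`.
  have s4 := (neg_le_abs _).trans (abs_two_mul_inner_le_smul hr (expMul μ z.fn) (expMul μ w))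
  have hwG := hG Xd w hw
  have s5 : p * (r⁻¹ * ‖expMul μ w‖ ^ 2) ≤ qd := by
    have h2 : p * r⁻¹ * ‖expMul μ w‖ ^ 2 ≤ p * r⁻¹ * (G * qd) :=
      mul_le_mul_of_nonneg_left hwG (by positivity)
    have h3 := mul_le_mul_of_nonneg_right hpr hqd0
    linarith
  -- `ε` is so small that the unweighted delayed terms cost at most `Nd` and `qd`.
  have s6 : -2 * (a2 * inner ℝ zd.fn z.dxx) ≤ ‖z.dxx‖ ^ 2 + a2 ^ 2 * ‖zd.fn‖ ^ 2 := by
    have h2 := (neg_le_abs _).trans (abs_two_mul_inner_le (a2 • zd.fn) z.dxx)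
    rw [real_inner_smul_left, norm_smul, mul_pow, Real.norm_eq_abs, sq_abs] at h2
    linarith
  have s7 := (le_abs_self _).trans (abs_two_mul_inner_le w z.dxx)
  have s8 : ε * (a2 ^ 2 * ‖zd.fn‖ ^ 2) ≤ Nd := by
    have h2 := mul_le_mul_of_nonneg_left (norm_sq_le_exp_mul_norm_expMul_sq hμ zd.fn)
      (mul_nonneg hε.le (sq_nonneg a2))
    have h3 := mul_le_mul_of_nonneg_right hεa hNd0
    linarith
  have s9 : ε * ‖w‖ ^ 2 ≤ qd := by
    have h2 := mul_le_mul_of_nonneg_left (norm_sq_le_exp_mul_norm_expMul_sq hμ w) hε.le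
    have h3 : ε * Real.exp (2 * μ) * ‖expMul μ w‖ ^ 2 ≤ ε * Real.exp (2 * μ) * (G * qd) :=
      mul_le_mul_of_nonneg_left hwG (by positivity)
    have h4 := mul_le_mul_of_nonneg_right hεG hqd0
    linarith
  have u1 := mul_le_mul_of_nonneg_right hκ hq0
  have u2 := mul_le_mul_of_nonneg_right hδ1 hqd0
  have u3 := mul_le_mul_of_nonneg_right hcμ (mul_nonneg hp0.le hN0)
  have u4 := mul_le_mul_of_nonneg_right hc (mul_nonneg hε.le (sq_nonneg ‖z.dx‖))
  have u5 := mul_le_mul_of_nonneg_right hδ1 (mul_nonneg hp0.le hNd0)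
  have u6 := mul_le_mul_of_nonneg_right hp hNd0
  have u7 : 0 ≤ |a1| * (p * Nd) := by positivity
  have u8 : 0 ≤ |a2| * qd := by positivity
  have u9 : 0 ≤ δ1 * (ε * ‖zd.dx‖ ^ 2) := by
    have : 0 ≤ δ1 := by linarith [abs_nonneg a1, abs_nonneg a2]
    positivity
  have v1 := hK X
  rw [← hq] at v1
  rw [← hN] at s4
  have v2 : 0 ≤ p * Y := mul_nonneg hp0.le (sq_nonneg _)
  have v3 := mul_le_mul_of_nonneg_left s3 hp0.le
  have v4 := mul_le_mul_of_nonneg_left s4 hp0.le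
  have v6 := mul_le_mul_of_nonneg_left s6 hε.le
  have v7 := mul_le_mul_of_nonneg_left s7 hε.le
  linarith

theorem bddAbove_normSqH1 {n : ℕ} {h : ℝ} {X : ℝ → Fin n → ℝ} {z : ℝ → H2} (hW : InW h X z) :
    BddAbove ((fun θ => normSqH1 (X θ) (z θ)) '' Icc (-h) 0) := by
  have h1 := continuous_H2_fn
  have h2 := continuous_H2_dx
  have h3 : Continuous fun Y : (Fin n → ℝ) × H2 => normSqH1 Y.1 Y.2 := by
    unfold normSqH1
    fun_prop
  exact isCompact_Icc.bddAbove_image (h3.comp_continuousOn hW.continuousOn)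

/-- The weighted Lyapunov function is equivalent to the square of the norm of `ℝⁿ × H¹(0,1)`. -/
theorem exists_lyap_equiv {n : ℕ} {P : Matrix (Fin n) (Fin n) ℝ} (hP : P.PosDef) {p ε μ : ℝ}
    (hp : 0 < p) (hε : 0 < ε) (hμ : 0 ≤ μ) : ∃ C1 C2 : ℝ, 0 < C1 ∧ 0 < C2 ∧ ∀ X z,
      normSqH1 X z ≤ C1 * lyap P p ε μ X z ∧ lyap P p ε μ X z ≤ C2 * normSqH1 X z := by
  obtain ⟨m, hm, hmP⟩ := exists_le_dotProduct_mulVec hP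
  obtain ⟨M, hM, hMP⟩ := exists_abs_dotProduct_mulVec_le P
  refine ⟨m⁻¹ + Real.exp (2 * μ) * p⁻¹ + ε⁻¹, M + p + ε, by positivity, by positivity,
    fun X z => ?_⟩
  have h1 := hmP X
  have h2 := (le_abs_self _).trans (hMP X)
  have h3 := norm_sq_le_exp_mul_norm_expMul_sq hμ z.fn
  have h4 := norm_expMul_sq_le hμ z.fn
  have h5 := dotProduct_self_nonneg X
  have h6 := dotProduct_mulVec_self_nonneg hP X
  rw [normSqH1, lyap]
  set D := ‖z.dx‖ ^ 2
  set Z := ‖z.fn‖ ^ 2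
  set N := ‖expMul μ z.fn‖ ^ 2
  have hD : 0 ≤ D := sq_nonneg _
  have hZ : 0 ≤ Z := sq_nonneg _
  have hN : 0 ≤ N := sq_nonneg _
  constructor
  · have e1 : X ⬝ᵥ X ≤ m⁻¹ * (X ⬝ᵥ P *ᵥ X) := by
      rw [inv_mul_eq_div, le_div_iff₀ hm]
      linarith
    have e2 : Z ≤ Real.exp (2 * μ) * p⁻¹ * (p * N) := by
      rw [mul_assoc, inv_mul_cancel_left₀ hp.ne']
      exact h3
    have e3 : D = ε⁻¹ * (ε * D) := by rw [inv_mul_cancel_left₀ hε.ne']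
    have f1 : 0 ≤ m⁻¹ * (p * N + ε * D) := by positivity
    have f2 : 0 ≤ Real.exp (2 * μ) * p⁻¹ * (X ⬝ᵥ P *ᵥ X + ε * D) := by positivity
    have f3 : 0 ≤ ε⁻¹ * (X ⬝ᵥ P *ᵥ X + p * N) := by positivity
    linarith
  · have e1 : p * N ≤ p * Z := mul_le_mul_of_nonneg_left h4 hp.le
    have f1 : 0 ≤ M * (Z + D) := by positivity
    have f2 : 0 ≤ p * (X ⬝ᵥ X + D) := by positivity
    have f3 : 0 ≤ ε * (X ⬝ᵥ X + Z) := by positivity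
    linarith

/-- If `|g(x) v| ≤ Γ e^{σx} |v|`, then the weight `e^{-(σ-1)x}` removes the growth of the coupling
term up to a factor `e`. -/
theorem norm_expMul_coupling_sq_le {n : ℕ} {A P : Matrix (Fin n) (Fin n) ℝ} {a a1 a2 : ℝ}
    {K : Matrix (Fin 1) (Fin n) ℝ} {c σ Γ m : ℝ} (hm : 0 < m)
    (hmP : ∀ x : Fin n → ℝ, m * (x ⬝ᵥ x) ≤ x ⬝ᵥ P *ᵥ x) (hΓ : 0 ≤ Γ)
    (hg : ∀ x ∈ Icc (0 : ℝ) 1, ∀ v : Fin n → ℝ,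
      |gFun A a K c x ⬝ᵥ v| ≤ Real.exp (σ * x) * (Γ * Real.sqrt (v ⬝ᵥ v)))
    {Xd : Fin n → ℝ} {w : L2} (hw : ∀ᵐ x ∂vol01, w x = gFun A a K c x ⬝ᵥ
      ((a1 • (1 : Matrix (Fin n) (Fin n) ℝ) - a2 • (1 : Matrix (Fin n) (Fin n) ℝ)) *ᵥ Xd)) :
    ‖expMul (σ - 1) w‖ ^ 2 ≤
      (Real.exp 1 * Γ * (a1 - a2)) ^ 2 * m⁻¹ * (Xd ⬝ᵥ P *ᵥ Xd) := by
  refine norm_sq_le_of_ae ?_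
  filter_upwards [hw, expMul_coeFn (σ - 1) w, ae_restrict_mem measurableSet_Ioo] with x hx hx1 hx2
  have e1 := hg x (Ioo_subset_Icc_self hx2) Xd
  rw [← sub_smul, smul_mulVec, one_mulVec, dotProduct_smul, smul_eq_mul] at hx
  have e2 : Real.exp (-(σ - 1) * x) * Real.exp (σ * x) ≤ Real.exp 1 := by
    rw [← Real.exp_add, Real.exp_le_exp]
    linarith [hx2.2]
  have e3 : |expMul (σ - 1) w x| ≤ Real.exp 1 * Γ * |a1 - a2| * Real.sqrt (Xd ⬝ᵥ Xd) := by
    rw [hx1, hx, abs_mul, abs_mul, Real.abs_exp]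
    calc Real.exp (-(σ - 1) * x) * (|a1 - a2| * |gFun A a K c x ⬝ᵥ Xd|)
        ≤ Real.exp (-(σ - 1) * x) *
            (|a1 - a2| * (Real.exp (σ * x) * (Γ * Real.sqrt (Xd ⬝ᵥ Xd)))) := by
          gcongr
      _ = Real.exp (-(σ - 1) * x) * Real.exp (σ * x) * (Γ * |a1 - a2| * Real.sqrt (Xd ⬝ᵥ Xd)) := by
          ring
      _ ≤ Real.exp 1 * (Γ * |a1 - a2| * Real.sqrt (Xd ⬝ᵥ Xd)) := by gcongr
      _ = Real.exp 1 * Γ * |a1 - a2| * Real.sqrt (Xd ⬝ᵥ Xd) := by ring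
  calc expMul (σ - 1) w x * expMul (σ - 1) w x = |expMul (σ - 1) w x| ^ 2 := by rw [sq_abs, sq]
    _ ≤ (Real.exp 1 * Γ * |a1 - a2| * Real.sqrt (Xd ⬝ᵥ Xd)) ^ 2 := by gcongr
    _ = (Real.exp 1 * Γ * (a1 - a2)) ^ 2 * (Xd ⬝ᵥ Xd) := by
        rw [mul_pow, mul_pow, Real.sq_sqrt (dotProduct_self_nonneg Xd), sq_abs, ← mul_pow]
    _ ≤ (Real.exp 1 * Γ * (a1 - a2)) ^ 2 * (m⁻¹ * (Xd ⬝ᵥ P *ᵥ Xd)) := by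
        refine mul_le_mul_of_nonneg_left ?_ (sq_nonneg _)
        rw [inv_mul_eq_div, le_div_iff₀ hm]
        linarith [hmP Xd]
    _ = _ := by ring

/-- A controllable pair with scalar delay matrix can be given every decay rate. The gain `K` and
`P` are fixed first; with `c = σ² - a` and the weight `e^{-(σ-1)x}`, the weighted coupling term is
bounded uniformly in `σ`, while `c - (σ-1)² = 2σ - 1 - a` is as large as desired. -/
theorem Controllable.exists_expStable {n : ℕ} {A : Matrix (Fin n) (Fin n) ℝ}
    {B : Matrix (Fin n) (Fin 1) ℝ} (hAB : Controllable A B) (a a1 a2 h : ℝ) {δ : ℝ} (hδ : 0 < δ) :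
    ∃ (K : Matrix (Fin 1) (Fin n) ℝ) (c : ℝ), 0 < c ∧
      ExpStable A (a1 • (1 : Matrix (Fin n) (Fin n) ℝ)) B a a2 K c h δ := by
  -- `δ₀` is chosen such that Halanay's inequality yields exactly the rate `δ`.
  obtain ⟨δ1, hδ1⟩ : ∃ x : ℝ, x = |a1| + |a2| + 2 := ⟨_, rfl⟩
  have hδ1pos : 0 < δ1 := by rw [hδ1]; positivity
  obtain ⟨δ0, hδ0⟩ : ∃ x : ℝ, x = δ + δ1 * Real.exp (2 * δ * h) := ⟨_, rfl⟩
  have hδ0pos : 0 < δ0 := by rw [hδ0]; positivity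
  obtain ⟨K, P, hP, hK⟩ := hAB.exists_gain (δ0 + (|a1| + 1) / 2)
  obtain ⟨Γ, hΓ, hg⟩ := exists_abs_gFun_dotProduct_le_exp A a K
  obtain ⟨m, hm, hmP⟩ := exists_le_dotProduct_mulVec hP
  obtain ⟨G, hG⟩ : ∃ x : ℝ, x = (Real.exp 1 * Γ * (a1 - a2)) ^ 2 * m⁻¹ := ⟨_, rfl⟩
  have hG0 : 0 ≤ G := by rw [hG]; positivity
  obtain ⟨p, hp⟩ : ∃ x : ℝ, x = B.col 0 ⬝ᵥ P *ᵥ B.col 0 + 1 := ⟨_, rfl⟩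
  have hp1 : 1 ≤ p := by linarith [dotProduct_mulVec_self_nonneg hP (B.col 0)]
  obtain ⟨r, hr⟩ : ∃ x : ℝ, x = p * G + 1 := ⟨_, rfl⟩
  have hr0 : 0 < r := by rw [hr]; positivity
  -- Only now `σ`, and with it `c`, is taken large; the constants above do not depend on it.
  obtain ⟨σ, hσ⟩ : ∃ x : ℝ, x = 1 + |a| + (2 * δ0 + 2 + |a2| + r) := ⟨_, rfl⟩
  obtain ⟨μ, hμ⟩ : ∃ x : ℝ, x = σ - 1 := ⟨_, rfl⟩
  obtain ⟨c, hc⟩ : ∃ x : ℝ, x = σ ^ 2 - a := ⟨_, rfl⟩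
  have haa := le_abs_self a
  have ha0 := abs_nonneg a
  have ha2 := abs_nonneg a2
  have hσ1 : 1 ≤ σ := by linarith
  have hμ0 : 0 ≤ μ := by linarith
  have hcδ : δ0 ≤ c := by nlinarith
  obtain ⟨ε, hε⟩ : ∃ x : ℝ, x = (Real.exp (2 * μ) * (G + a2 ^ 2 + 1))⁻¹ := ⟨_, rfl⟩
  have hE : 0 < Real.exp (2 * μ) * (G + a2 ^ 2 + 1) := by positivity
  have hε0 : 0 < ε := hε ▸ inv_pos.mpr hE
  have hε1 : ε * (Real.exp (2 * μ) * (G + a2 ^ 2 + 1)) = 1 := by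
    rw [hε, inv_mul_cancel₀ hE.ne']
  have hεe : 0 < ε * Real.exp (2 * μ) := by positivity
  have hεG : ε * Real.exp (2 * μ) * G ≤ 1 := by
    nlinarith [mul_nonneg hεe.le (sq_nonneg a2)]
  have hεa : ε * Real.exp (2 * μ) * a2 ^ 2 ≤ 1 := by
    nlinarith [mul_nonneg hεe.le hG0]
  have hpr : p * r⁻¹ * G ≤ 1 := by
    rw [mul_right_comm, ← div_eq_mul_inv, div_le_one hr0]
    linarith
  have hcμ : 2 * δ0 + 2 + |a2| + r ≤ 2 * (c - μ ^ 2) := by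
    have : c - μ ^ 2 = 2 * σ - 1 - a := by
      rw [hc, hμ]
      ring
    linarith
  have hGw := fun (Xd : Fin n → ℝ) (w : L2) => norm_expMul_coupling_sq_le (a1 := a1) (a2 := a2)
    hm hmP hΓ (σ := σ) (hg c σ (by linarith) (by rw [hc]; ring)) (Xd := Xd) (w := w)
  rw [← hμ, ← hG] at hGw
  obtain ⟨C1, C2, hC1, hC2, hC⟩ := exists_lyap_equiv hP (by linarith : 0 < p) hε0 hμ0
  refine ⟨K, c, by linarith, C1 * C2, by positivity, ?_⟩
  intro h0 hh0 τ hτ X z hW hsol t ht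
  have key := lyap_le_of_dissipation (μ := μ) (p1 := p) (p2 := ε) (δ0 := δ0) hP (by linarith)
    hε0.le hδ1pos hδ (by rw [hδ0]; ring)
    (fun X Xd z zd zt w e0 e1 e2 e3 => dissipation_of_weight hP hK hμ0 hp1 hr0 hε0 hGw
      (by linarith) hpr hεG hεa (by linarith) (by linarith) hcμ hcδ e0 e1 e2 e3) hh0 hτ hW hsol ht
  have hh : 0 ≤ h := hh0.le.trans ((hτ.2 0 self_mem_Ici).1.trans (hτ.2 0 self_mem_Ici).2)
  have hsup : histSup h (fun θ => lyap P p ε μ (X θ) (z θ)) ≤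
      C2 * histSup h (fun θ => normSqH1 (X θ) (z θ)) := by
    refine csSup_le ((nonempty_Icc.mpr (by linarith)).image _) ?_
    rintro _ ⟨θ, hθ, rfl⟩
    exact (hC (X θ) (z θ)).2.trans (mul_le_mul_of_nonneg_left
      (le_csSup (bddAbove_normSqH1 hW) ⟨θ, hθ, rfl⟩) hC2.le)
  calc normSqH1 (X t) (z t) ≤ C1 * lyap P p ε μ (X t) (z t) := (hC _ _).1
    _ ≤ C1 * (Real.exp (-2 * δ * t) * (C2 * histSup h (fun θ => normSqH1 (X θ) (z θ)))) := by
        refine mul_le_mul_of_nonneg_left (key.trans ?_) hC1.le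
        exact mul_le_mul_of_nonneg_left hsup (Real.exp_pos _).le
    _ = C1 * C2 * Real.exp (-2 * δ * t) * histSup h (fun θ => normSqH1 (X θ) (z θ)) := by ring

end HeatODE

end

theorem mainTheorem2 {n : ℕ} (A A1 : Matrix (Fin n) (Fin n) ℝ) (B : Matrix (Fin n) (Fin 1) ℝ)
    (a a2 : ℝ) :
    (∀ (K : Matrix (Fin 1) (Fin n) ℝ) (c : ℝ), 0 < c →
      ∀ r r1 : ℝ, 0 < r → 0 < r1 → r1 < 2 →
      ∀ (P : Matrix (Fin n) (Fin n) ℝ) (p1 p2 lam lam1 : ℝ),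
      (∀ δ0 δ1 : ℝ, 0 < δ1 → δ1 < δ0 →
        HeatODE.NeumannLMI A A1 B a a2 K c r r1 δ0 δ1 P p1 p2 lam lam1 →
        ∀ h : ℝ, 0 < h →
          (∃! δ : ℝ, δ = δ0 - δ1 * Real.exp (2 * δ * h)) ∧
          ∀ δ : ℝ, δ = δ0 - δ1 * Real.exp (2 * δ * h) →
            0 < δ ∧ HeatODE.StableInV1 A A1 B a a2 K c P p1 p2 h δ) ∧
      (∀ δ0 : ℝ, 0 < δ0 →
        HeatODE.NeumannLMI A A1 B a a2 K c r r1 δ0 δ0 P p1 p2 lam lam1 →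
        ∀ h : ℝ, 0 < h → ∃ δ : ℝ, 0 < δ ∧ HeatODE.StableInV1 A A1 B a a2 K c P p1 p2 h δ)) ∧
    (HeatODE.Controllable A B →
      ∀ a1 : ℝ, A1 = a1 • (1 : Matrix (Fin n) (Fin n) ℝ) →
      ∀ h : ℝ, 0 < h → ∀ δ : ℝ, 0 < δ →
        ∃ (K : Matrix (Fin 1) (Fin n) ℝ) (c : ℝ), 0 < c ∧
          HeatODE.ExpStable A A1 B a a2 K c h δ) := by
  refine ⟨fun K c _ r r1 hr hr1 _ P p1 p2 lam lam1 => ⟨?_, ?_⟩, ?_⟩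
  · intro δ0 δ1 hδ1 h01 hL h hh
    exact ⟨HeatODE.existsUnique_halanayRate δ0 hδ1 hh, fun δ hδ =>
      ⟨HeatODE.halanayRate_pos hδ1 h01 hh hδ, hL.stableInV1 hr hr1 hδ1 h01 hh hδ⟩⟩
  · intro δ0 hδ0 hL h hh
    obtain ⟨δ1, hδ1, h01, hL1⟩ := hL.exists_lt hδ0
    obtain ⟨δ, hδ, -⟩ := HeatODE.existsUnique_halanayRate δ0 hδ1 hh
    exact ⟨δ, HeatODE.halanayRate_pos hδ1 h01 hh hδ, hL1.stableInV1 hr hr1 hδ1 h01 hh hδ⟩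
  · rintro hAB a1 rfl h _ δ hδ
    exact hAB.exists_expStable a a1 a2 h hδ
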